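/- Let $(\Omega,\mathcal F,\mathbb P)$ be a probability space, $\theta:\Omega\to\Omega$ a bi-measurable, measure-preserving, ergodic bijection, $\Xi$ a compact metric space and $d\in\mathbb N$. Let $$T(\omega,\xi,y)=(\theta\omega,\,g_\omega(\xi),\,h_{\omega,\xi}(y))$$ be a random map on $\Omega\times\Xi\times\mathbb R^d$: each $g_\omega:\Xi\to\Xi$ is a homeomorphism; for each $\omega$ the map $(\xi,y)\mapsto h_{\omega,\xi}(y)\in\mathbb R^d$ is continuous and is differentiable in $y$ with derivative continuous in $(\xi,y)$; and $\omega\mapsto g_\omega(\xi)$, $\omega\mapsto h_{\omega,\xi}(y)$ are measurable for all $\xi,y$. Put $T_\omega(\xi,y)=(g_\omega(\xi),h_{\omega,\xi}(y))$, let $h^n_{\omega,\xi}(y)$ be the $\mathbb R^d$-component of $T^n(\omega,\xi,y)$, and let $$\Phi_n(\omega,\xi,y)=\log\|D_yh^n_{\omega,\xi}(y)\|\in[-\infty,\infty)\qquad(\log 0=-\infty).$$ Let $K\subseteq\Omega\times\Xi\times\mathbb R^d$ be a random compact set, that is, every fibre $K(\omega)=\{(\xi,y):(\omega,\xi,y)\in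 K\}$ is compact and $\omega\mapsto d(x,K(\omega))$ is measurable for every $x\in\Xi\times\mathbb R^d$ (with $d(x,\emptyset)=\infty$). Assume: 1. $K$ is $T$-invariant: $T_\omega(K(\omega))=K(\theta\omega)$ for $\mathbb P$-a.e. $\omega$. 2. $K$ has connected fibres: for $\mathbb P$-a.e. $\omega$ and all $\xi\in\Xi$ the set $K(\omega,\xi)=\{y:(\omega,\xi,y)\in K\}$ is non-empty and connected. 3. $\sup\{\Phi_1(\omega,\xi,y):\omega\in\Omega,\ (\xi,y)\in K(\omega)\}<\infty$, and for all $k\in\mathbb N$ and $\varepsilon>0$ there is $r>0$ such that $$\sup\{\Phi_k(\omega,\xi,y):\omega\in\Omega,\ (\xi,y)\in B_r(K(\omega))\}\le\sup\{\Phi_k(\omega,\xi,y):\omega\in\Omega,\ (\xi,y)\in K(\omega)\}+\varepsilon,$$ where $B_r(K(\omega))=\{x\in\Xi\times\mathbb R^d: d(x,K(\omega))<r\}$ and $d$ is the product (maximum) metric. 4. $\lambda(\mu,T)=\inf_{n\ge1}\frac1n\int\Phi_n\,d\mu<0$ for every $T$-invariant probability measure $\mu$ on $\Omega\times\Xi\times\mathbb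 R^d$ that projects to $\mathbb P$ and is supported on $K$ (i.e. $\mu(K)=1$). Then there is a function $\phi:\Omega\times\Xi\to\mathbb R^d$ such that $\xi\mapsto\phi(\omega,\xi)$ is continuous for every $\omega\in\Omega$, $\omega\mapsto\phi(\omega,\xi)$ is measurable for every $\xi\in\Xi$, and $$K(\omega)=\{(\xi,\phi(\omega,\xi)):\xi\in\Xi\}\qquad\text{for }\mathbb P\text{-a.e. }\omega\in\Omega.$$ -/

import Mathlib

open MeasureTheory

namespace RandomForcing

noncomputable section

/-- The fibre `K(ω) = {x | (ω, x) ∈ K}` of a set `K ⊆ Ω × M`. -/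
def fiber {Ω M : Type*} (K : Set (Ω × M)) (ω : Ω) : Set M :=
  {x | (ω, x) ∈ K}

/-- Random compact sets: every fibre is compact and `ω ↦ d(x, K(ω))` is measurable for every `x`
(the distance to the empty set being `∞`). -/
structure IsRandomCompact {Ω M : Type*} [MeasurableSpace Ω] [PseudoEMetricSpace M]
    (K : Set (Ω × M)) : Prop where
  isCompact_fiber : ∀ ω, IsCompact (fiber K ω)
  measurable_infEDist : ∀ x, Measurable fun ω => Metric.infEDist x (fiber K ω)

/-- Random continuous functions: continuous in `x ∈ M` for every `ω`, and measurable in `ω` for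
every `x`. -/
structure IsRandomContinuous {Ω M N : Type*} [MeasurableSpace Ω] [TopologicalSpace M]
    [TopologicalSpace N] [MeasurableSpace N] (Φ : Ω × M → N) : Prop where
  continuous_right : ∀ ω, Continuous fun x => Φ (ω, x)
  measurable_left : ∀ x, Measurable fun ω => Φ (ω, x)

/-- The data of a random map with double skew product structure
`T(ω, ξ, y) = (θ ω, g_ω(ξ), h_{ω,ξ}(y))` on `Ω × Ξ × ℝ^d` over an ergodic, invertible,
measure-preserving base `(Ω, P, θ)`: each `g_ω` is a homeomorphism of `Ξ`, the map
`(ξ, y) ↦ h_{ω,ξ}(y)` is continuous, it is differentiable in `y`, its derivative in `y` is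
continuous in `(ξ, y)`, and all maps are measurable in `ω`. -/
structure DoubleSkewProduct {Ω : Type*} [MeasurableSpace Ω] (P : Measure Ω)
    (Ξ : Type*) [MetricSpace Ξ] [MeasurableSpace Ξ] (d : ℕ) where
  θ : Ω ≃ᵐ Ω
  ergodic_θ : Ergodic θ P
  g : Ω → Ξ ≃ₜ Ξ
  measurable_g : ∀ ξ, Measurable fun ω => g ω ξ
  h : Ω → Ξ → EuclideanSpace ℝ (Fin d) → EuclideanSpace ℝ (Fin d)
  measurable_h : ∀ ξ y, Measurable fun ω => h ω ξ y
  continuous_h : ∀ ω, Continuous fun p : Ξ × EuclideanSpace ℝ (Fin d) => h ω p.1 p.2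
  differentiable_h : ∀ ω ξ, Differentiable ℝ (h ω ξ)
  continuous_fderiv_h : ∀ ω,
    Continuous fun p : Ξ × EuclideanSpace ℝ (Fin d) => fderiv ℝ (h ω p.1) p.2

/-- The integral of an extended real valued function, as the difference of the integrals of its
positive and negative parts. It is meaningful if one of the two integrals is finite; below it is
used for functions that are almost everywhere bounded from above. -/
def extIntegral {X : Type*} [MeasurableSpace X] (μ : Measure X) (f : X → EReal) : EReal :=
  ((∫⁻ x, (f x).toENNReal ∂μ : ENNReal) : EReal) -
    ((∫⁻ x, (-f x).toENNReal ∂μ : ENNReal) : EReal)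

namespace DoubleSkewProduct

variable {Ω : Type*} [MeasurableSpace Ω] {P : Measure Ω}
  {Ξ : Type*} [MetricSpace Ξ] [MeasurableSpace Ξ] {d : ℕ}

/-- The fibre map `T_ω(ξ, y) = (g_ω(ξ), h_{ω,ξ}(y))`. -/
def fiberMap (T : DoubleSkewProduct P Ξ d) (ω : Ω)
    (p : Ξ × EuclideanSpace ℝ (Fin d)) : Ξ × EuclideanSpace ℝ (Fin d) :=
  (T.g ω p.1, T.h ω p.1 p.2)

/-- The skew product map `T` on `Ω × (Ξ × ℝ^d)`. -/
def map (T : DoubleSkewProduct P Ξ d)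
    (x : Ω × Ξ × EuclideanSpace ℝ (Fin d)) : Ω × Ξ × EuclideanSpace ℝ (Fin d) :=
  (T.θ x.1, T.fiberMap x.1 x.2)

/-- `h^n_{ω,ξ}(y)`, the `ℝ^d`-component of `T^n(ω, ξ, y)`. -/
def hIter (T : DoubleSkewProduct P Ξ d) (n : ℕ) (ω : Ω) (ξ : Ξ)
    (y : EuclideanSpace ℝ (Fin d)) : EuclideanSpace ℝ (Fin d) :=
  (T.map^[n] (ω, ξ, y)).2.2

/-- `Φ_n(ω, ξ, y) = log ‖D_y h^n_{ω,ξ}(y)‖ ∈ [-∞, ∞)`, with `log 0 = -∞`. -/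
def Phi (T : DoubleSkewProduct P Ξ d) (n : ℕ)
    (x : Ω × Ξ × EuclideanSpace ℝ (Fin d)) : EReal :=
  ENNReal.log ‖fderiv ℝ (T.hIter n x.1 x.2.1) x.2.2‖ₑ

/-- `T`-invariance of a set `K`: `T_ω(K(ω)) = K(θ ω)` for almost every `ω`. -/
def IsInvariant (T : DoubleSkewProduct P Ξ d)
    (K : Set (Ω × Ξ × EuclideanSpace ℝ (Fin d))) : Prop :=
  ∀ᵐ ω ∂P, T.fiberMap ω '' fiber K ω = fiber K (T.θ ω)

/-- The `T`-invariant probability measures that project to `P` and are supported on `K`. -/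
def invariantMeasures (T : DoubleSkewProduct P Ξ d)
    (K : Set (Ω × Ξ × EuclideanSpace ℝ (Fin d))) :
    Set (Measure (Ω × Ξ × EuclideanSpace ℝ (Fin d))) :=
  {μ | IsProbabilityMeasure μ ∧ MeasurePreserving T.map μ μ ∧ μ.map Prod.fst = P ∧
    ∀ᵐ x ∂μ, x ∈ K}

/-- The maximal Lyapunov exponent `λ(μ, T) = inf_{n ≥ 1} (1/n) ∫ Φ_n dμ`. -/
def lyapunov (T : DoubleSkewProduct P Ξ d)
    (μ : Measure (Ω × Ξ × EuclideanSpace ℝ (Fin d))) : EReal :=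
  ⨅ n : {n : ℕ // 1 ≤ n}, extIntegral μ (T.Phi n) / ((n : ℕ) : EReal)

/-- The uniform derivative condition: for all `k` and `ε > 0` there is `r > 0` such that the
supremum of `Φ_k` over the fibrewise `r`-neighbourhood of `K` exceeds the supremum of `Φ_k`
over `K` by at most `ε`. -/
def UniformDerivative (T : DoubleSkewProduct P Ξ d)
    (K : Set (Ω × Ξ × EuclideanSpace ℝ (Fin d))) : Prop :=
  ∀ k : ℕ, ∀ ε : ℝ, 0 < ε → ∃ r : ℝ, 0 < r ∧
    (⨆ (ω : Ω) (p ∈ Metric.thickening r (fiber K ω)), T.Phi k (ω, p)) ≤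
      (⨆ (ω : Ω) (p ∈ fiber K ω), T.Phi k (ω, p)) + (ε : EReal)

/-- Connected fibres: for almost every `ω`, all sets `K(ω, ξ) = {y | (ω, ξ, y) ∈ K}` are
connected (and in particular non-empty). -/
def HasConnectedFibers (P : Measure Ω)
    (K : Set (Ω × Ξ × EuclideanSpace ℝ (Fin d))) : Prop :=
  ∀ᵐ ω ∂P, ∀ ξ : Ξ, IsConnected {y : EuclideanSpace ℝ (Fin d) | (ω, ξ, y) ∈ K}

end DoubleSkewProduct

end

end RandomForcing

open MeasureTheory Filter Topology Set ProbabilityTheory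
open scoped ENNReal NNReal BoundedContinuousFunction

/-! The fibres of K over Ω × Ξ are shown to be single points. Once they are, compactness of the
fibres K(ω) makes the graph function continuous, and measurability follows because hitting a closed
set is a measurable event for a random compact set.

The case k = 1 of the derivative condition bounds the expansion by `exp C` near K. The decisive step
(`exists_integral_neg`) produces a number m of steps, a tube around K and an integrable function c
of negative mean that dominates the truncated m-step logarithmic derivative in the tube. Otherwise,
for every N, a measurable almost maximizer of the truncated derivative over a thin tube has mean at
least -1. Averaging along its orbit, reached from the past so as to lie over ω, gives a Markov
kernel that is nearly invariant, nearly carried by K, and has nearly nonnegative mean expansion. A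
limit of such kernels would be an invariant measure on K with nonnegative exponent, contrary to
assumption.

Since Ω has no topology, the limit comes from Hilbert space geometry: the sets of approximating
kernels decrease and are closed under midpoints, so elements of almost minimal L² norm form a Cauchy
sequence (`exists_cauchySeq_of_midpoint`). A subsequence then converges weakly over almost every ω
(`exists_ae_tendsto_kernel`).

Given c, a maximal ergodic argument shows that its Birkhoff sums drift to -∞. Close points of K over
a common ξ therefore contract. A connected fibre is covered by a number of small balls independent
of ξ, so whole fibres shrink uniformly along the forward orbit. As θ preserves P, the event of
having a fibre of diameter at least η has the probability of its preimages under θ^L, which tends to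
0. -/

namespace RandomForcing

/-! ### Growth over blocks, and selection in a Hilbert space -/

/-- If a nonnegative sequence grows by at most the factor `E` in one step and by at most the factor
`q i` in `m` steps from time `i`, then it is controlled by the geometric mean of the `q i`. -/
theorem pow_le_mul_prod_of_block {a q : ℕ → ℝ} {E : ℝ} (hE : 1 ≤ E) (ha : ∀ i, 0 ≤ a i)
    (hq : ∀ i, 0 ≤ q i) {m k : ℕ} (hm : 1 ≤ m) (h1 : ∀ i < k + m, a (i + 1) ≤ E * a i)
    (h2 : ∀ i < k, a (i + m) ≤ q i * a i) :
    a (k + m) ^ m ≤ E ^ (2 * m * m) * a 0 ^ m * ∏ i ∈ Finset.range k, q i := by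
  have hE0 : 0 ≤ E := zero_le_one.trans hE
  have growth : ∀ l i, i + l ≤ k + m → a (i + l) ≤ E ^ l * a i := by
    intro l
    induction l with
    | zero => intro i _; simp
    | succ l ih =>
      intro i hi
      calc a (i + (l + 1)) ≤ E * a (i + l) := h1 (i + l) (by omega)
        _ ≤ E * (E ^ l * a i) := by gcongr; exact ih i (by omega)
        _ = E ^ (l + 1) * a i := by ring
  -- Shifting the window product by one replaces the factor a i by a (i + m), so it changes by at
  -- most q i. Comparing the first and the last window with a 0 and a (k + m) costs E ^ (m * m)
  -- each.
  set V : ℕ → ℝ := fun i => ∏ j ∈ Finset.range m, a (i + j) with hV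
  have hV0 : ∀ i, 0 ≤ V i := fun i => Finset.prod_nonneg fun j _ => ha _
  have hstep : ∀ i < k, V (i + 1) ≤ q i * V i := by
    intro i hi
    have hswap : V (i + 1) * a i = V i * a (i + m) := by
      have e1 := Finset.prod_range_succ (fun j => a (i + j)) m
      have e2 := Finset.prod_range_succ' (fun j => a (i + j)) m
      simp only [hV]
      rw [← e1, e2, add_zero]
      refine congrArg (· * a i) (Finset.prod_congr rfl fun j _ => ?_)
      rw [add_assoc, add_comm 1 j]
    rcases (ha i).eq_or_lt with h0 | hpos
    -- If a i = 0, one cannot cancel it, but then a (i + 1) also vanishes and is a factor of the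
    -- shifted window.
    · have : a (i + 1) = 0 := le_antisymm (by simpa [← h0] using h1 i (by omega)) (ha _)
      have hz : V (i + 1) = 0 :=
        Finset.prod_eq_zero (i := 0) (Finset.mem_range.2 hm) (by simpa using this)
      rw [hz]; exact mul_nonneg (hq _) (hV0 _)
    · refine le_of_mul_le_mul_right ?_ hpos
      calc V (i + 1) * a i = V i * a (i + m) := hswap
        _ ≤ V i * (q i * a i) := by gcongr; exacts [hV0 i, h2 i hi]
        _ = q i * V i * a i := by ring
  have hVk : ∀ l ≤ k, V l ≤ V 0 * ∏ i ∈ Finset.range l, q i := by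
    intro l
    induction l with
    | zero => intro _; simp
    | succ l ih =>
      intro hl
      calc V (l + 1) ≤ q l * V l := hstep l (by omega)
        _ ≤ q l * (V 0 * ∏ i ∈ Finset.range l, q i) := by gcongr; exacts [hq l, ih (by omega)]
        _ = _ := by rw [Finset.prod_range_succ]; ring
  have hV0le : V 0 ≤ E ^ (m * m) * a 0 ^ m := by
    calc V 0 ≤ ∏ j ∈ Finset.range m, (E ^ m * a 0) := by
          refine Finset.prod_le_prod (fun j _ => ha _) fun j hj => ?_
          have hj' := Finset.mem_range.1 hj
          refine (growth j 0 (by omega)).trans ?_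
          gcongr
          exact ha 0
      _ = E ^ (m * m) * a 0 ^ m := by simp [mul_pow, pow_mul]
  have hlast : a (k + m) ^ m ≤ E ^ (m * m) * V k := by
    calc a (k + m) ^ m = ∏ j ∈ Finset.range m, a (k + m) := by simp
      _ ≤ ∏ j ∈ Finset.range m, (E ^ m * a (k + j)) := by
          refine Finset.prod_le_prod (fun j _ => ha _) fun j hj => ?_
          have hj' := Finset.mem_range.1 hj
          have := growth (m - j) (k + j) (by omega)
          rw [show k + j + (m - j) = k + m by omega] at this
          refine this.trans ?_
          gcongr
          exacts [ha _, Nat.sub_le _ _]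
      _ = E ^ (m * m) * V k := by simp [hV, Finset.prod_mul_distrib, pow_mul]
  calc a (k + m) ^ m ≤ E ^ (m * m) * V k := hlast
    _ ≤ E ^ (m * m) * ((E ^ (m * m) * a 0 ^ m) * ∏ i ∈ Finset.range k, q i) := by
        gcongr
        refine (hVk k le_rfl).trans ?_
        gcongr
        exact Finset.prod_nonneg fun i _ => hq i
    _ = _ := by rw [show 2 * m * m = m * m + m * m by ring, pow_add]; ring

/-- In a decreasing sequence of nonempty bounded sets closed under midpoints in an inner product
space one can select a Cauchy sequence. -/
theorem exists_cauchySeq_of_midpoint {α H : Type*} [NormedAddCommGroup H] [InnerProductSpace ℝ H]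
    (V : α → H) (S : ℕ → Set α) (hanti : Antitone S) (hne : ∀ n, (S n).Nonempty)
    (hmid : ∀ n, ∀ a ∈ S n, ∀ b ∈ S n, ∃ c ∈ S n, V c = (1 / 2 : ℝ) • (V a + V b))
    {B : ℝ} (hB : ∀ a ∈ S 0, ‖V a‖ ≤ B) :
    ∃ s : ℕ → α, (∀ n, s n ∈ S n) ∧ CauchySeq fun n => V (s n) := by
  set I : ℕ → ℝ := fun n => sInf ((fun a => ‖V a‖ ^ 2) '' S n) with hI
  have hbdd : ∀ n, BddBelow ((fun a => ‖V a‖ ^ 2) '' S n) :=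
    fun n => ⟨0, by rintro _ ⟨a, _, rfl⟩; positivity⟩
  have hIle : ∀ n, ∀ a ∈ S n, I n ≤ ‖V a‖ ^ 2 := fun n a ha => csInf_le (hbdd n) ⟨a, ha, rfl⟩
  have hmono : Monotone I := fun n m hnm =>
    csInf_le_csInf (hbdd n) ((hne m).image _) (image_mono (hanti hnm))
  have hIB : BddAbove (range I) := by
    refine ⟨B ^ 2, ?_⟩
    rintro _ ⟨n, rfl⟩
    obtain ⟨a, ha⟩ := hne n
    refine (hIle n a ha).trans ?_
    gcongr
    exact hB a (hanti n.zero_le ha)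
  have hlim := tendsto_atTop_ciSup hmono hIB
  set J := ⨆ n, I n
  have hsel : ∀ n : ℕ, ∃ a ∈ S n, ‖V a‖ ^ 2 < I n + 1 / ((n : ℝ) + 1) := by
    intro n
    obtain ⟨_, ⟨a, ha, rfl⟩, hlt⟩ := exists_lt_of_csInf_lt ((hne n).image fun a => ‖V a‖ ^ 2)
      (show I n < I n + 1 / ((n : ℝ) + 1) by
        have : (0 : ℝ) < 1 / ((n : ℝ) + 1) := by positivity
        linarith)
    exact ⟨a, ha, hlt⟩
  choose s hs hslt using hsel
  refine ⟨s, hs, ?_⟩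
  -- Parallelogram law: both norms are almost the infima I n and I m, while the midpoint lies in S n
  -- and has squared norm at least I n. The difference is thus controlled by the increment of I,
  -- which is monotone and bounded.
  have key : ∀ N n m, N ≤ n → n ≤ m →
      ‖V (s n) - V (s m)‖ ^ 2 ≤ 2 * (J - I N) + 4 * (1 / ((N : ℝ) + 1)) := by
    intro N n m hN hnm
    obtain ⟨c, hc, hVc⟩ := hmid n (s n) (hs n) (s m) (hanti hnm (hs m))
    have h1 := hIle n c hc
    rw [hVc, norm_smul, mul_pow] at h1
    have h2 := parallelogram_law_with_norm ℝ (V (s n)) (V (s m))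
    have h3 := hslt n
    have h4 := hslt m
    have h5 : I N ≤ I n := hmono hN
    have h6 : I m ≤ J := le_ciSup hIB m
    have h7 : 1 / ((n : ℝ) + 1) ≤ 1 / ((N : ℝ) + 1) := by gcongr
    have h8 : 1 / ((m : ℝ) + 1) ≤ 1 / ((N : ℝ) + 1) := by gcongr; exact hN.trans hnm
    norm_num at h1
    nlinarith
  refine cauchySeq_of_le_tendsto_0
    (fun N => √(2 * (J - I N) + 4 * (1 / ((N : ℝ) + 1)))) ?_ ?_
  · intro n m N hn hm
    rw [dist_eq_norm]
    refine Real.le_sqrt_of_sq_le ?_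
    rcases le_total n m with h | h
    · exact key N n m hn h
    · rw [norm_sub_rev]; exact key N m n hm h
  · have h1 : Tendsto (fun N => 2 * (J - I N) + 4 * (1 / ((N : ℝ) + 1))) atTop
        (𝓝 (2 * (J - J) + 4 * 0)) :=
      ((tendsto_const_nhds.sub hlim).const_mul 2).add
        (tendsto_one_div_add_atTop_nhds_zero_nat.const_mul 4)
    simpa using h1.sqrt

/-! ### Maximal ergodic inequality and negative drift -/

/-- The truncated maxima of Birkhoff sums: `max (0, S₁ f, …, Sₙ f)`. -/
noncomputable def maxBirkhoff {Ω : Type*} (θ : Ω → Ω) (f : Ω → ℝ) : ℕ → Ω → ℝ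
  | 0 => fun _ => 0
  | n + 1 => fun ω => max 0 (f ω + maxBirkhoff θ f n (θ ω))

theorem maxBirkhoff_nonneg {Ω : Type*} (θ : Ω → Ω) (f : Ω → ℝ) (n : ℕ) (ω : Ω) :
    0 ≤ maxBirkhoff θ f n ω := by
  cases n with
  | zero => exact le_rfl
  | succ n => exact le_max_left _ _

theorem maxBirkhoff_le_succ {Ω : Type*} (θ : Ω → Ω) (f : Ω → ℝ) (n : ℕ) :
    ∀ ω, maxBirkhoff θ f n ω ≤ maxBirkhoff θ f (n + 1) ω := by
  induction n with
  | zero => exact fun ω => maxBirkhoff_nonneg θ f 1 ω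
  | succ n ih =>
    intro ω
    exact max_le_max le_rfl (add_le_add le_rfl (ih (θ ω)))

theorem sum_le_maxBirkhoff {Ω : Type*} (θ : Ω → Ω) (f : Ω → ℝ) (n : ℕ) :
    ∀ ω, ∑ i ∈ Finset.range n, f (θ^[i] ω) ≤ maxBirkhoff θ f n ω := by
  induction n with
  | zero => intro ω; simp [maxBirkhoff]
  | succ n ih =>
    intro ω
    rw [Finset.sum_range_succ']
    refine le_trans ?_ (le_max_right _ _)
    have := ih (θ ω)
    simp only [Function.iterate_succ, Function.comp_apply, Function.iterate_zero, id]
    linarith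

theorem integrable_maxBirkhoff {Ω : Type*} [MeasurableSpace Ω] {P : Measure Ω} {θ : Ω → Ω}
    (hθ : MeasurePreserving θ P P) {f : Ω → ℝ} (hf : Integrable f P) (n : ℕ) :
    Integrable (maxBirkhoff θ f n) P := by
  induction n with
  | zero => exact integrable_zero _ _ _
  | succ n ih =>
    exact (integrable_zero _ _ _).sup (hf.add (hθ.integrable_comp_of_integrable ih))

theorem measurable_maxBirkhoff {Ω : Type*} [MeasurableSpace Ω] {θ : Ω → Ω}
    (hθ : Measurable θ) {f : Ω → ℝ} (hf : Measurable f) (n : ℕ) :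
    Measurable (maxBirkhoff θ f n) := by
  induction n with
  | zero => exact measurable_const
  | succ n ih => exact measurable_const.max (hf.add (ih.comp hθ))

/-- Maximal ergodic inequality. -/
theorem setIntegral_maxBirkhoff_nonneg {Ω : Type*} [MeasurableSpace Ω] {P : Measure Ω} {θ : Ω → Ω}
    (hθ : MeasurePreserving θ P P) {f : Ω → ℝ} (hf : Integrable f P) (hfm : Measurable f) (n : ℕ) :
    0 ≤ ∫ ω in {ω | 0 < maxBirkhoff θ f n ω}, f ω ∂P := by
  cases n with
  | zero => simp [maxBirkhoff]
  | succ n =>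
    set F := maxBirkhoff θ f
    set A := {ω | 0 < F (n + 1) ω} with hA
    have hFi := fun k => integrable_maxBirkhoff hθ hf k
    have hAm : MeasurableSet A :=
      measurableSet_lt measurable_const (measurable_maxBirkhoff hθ.measurable hfm _)
    have hcomp : Integrable (fun ω => F n (θ ω)) P := hθ.integrable_comp_of_integrable (hFi n)
    have h1 : ∫ ω in A, F (n + 1) ω ∂P = ∫ ω, F (n + 1) ω ∂P := by
      refine setIntegral_eq_integral_of_forall_compl_eq_zero fun ω hω => ?_
      exact le_antisymm (not_lt.1 hω) (maxBirkhoff_nonneg _ _ _ _)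
    have h2 : ∫ ω in A, F n (θ ω) ∂P ≤ ∫ ω, F n (θ ω) ∂P :=
      setIntegral_le_integral hcomp (ae_of_all _ fun ω => maxBirkhoff_nonneg _ _ _ _)
    have h3 : ∫ ω, F n (θ ω) ∂P = ∫ ω, F n ω ∂P := by
      have := integral_map (μ := P) hθ.measurable.aemeasurable (f := F n)
        (by rw [hθ.map_eq]; exact (hFi n).aestronglyMeasurable)
      rw [hθ.map_eq] at this
      exact this.symm
    have h4 : ∫ ω, F n ω ∂P ≤ ∫ ω, F (n + 1) ω ∂P :=
      integral_mono (hFi n) (hFi _) (maxBirkhoff_le_succ θ f n)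
    -- Where F (n + 1) is positive, the maximum in its recursion is attained by the second term, so
    -- f is a difference whose integral is nonnegative by invariance of P.
    have h5 : ∫ ω in A, f ω ∂P = ∫ ω in A, (F (n + 1) ω - F n (θ ω)) ∂P := by
      refine setIntegral_congr_fun hAm fun ω hω => ?_
      have hω' : 0 < max 0 (f ω + F n (θ ω)) := hω
      have : F (n + 1) ω = f ω + F n (θ ω) :=
        max_eq_right (le_of_lt ((lt_max_iff.1 hω').resolve_left (lt_irrefl _)))
      simp only [this]; ring
    rw [h5, integral_sub (hFi _).integrableOn hcomp.integrableOn]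
    linarith

/-- Birkhoff sums of an integrable function with negative mean have linear negative drift. -/
theorem ae_exists_sum_le_of_integral_neg {Ω : Type*} [MeasurableSpace Ω] {P : Measure Ω}
    [IsProbabilityMeasure P] {θ : Ω → Ω} (hθ : Ergodic θ P) {c : Ω → ℝ} (hc : Integrable c P)
    (hcm : Measurable c) (hneg : ∫ ω, c ω ∂P < 0) :
    ∃ ε : ℝ, 0 < ε ∧ ∀ᵐ ω ∂P, ∃ B : ℝ, 0 ≤ B ∧
      ∀ k : ℕ, ∑ i ∈ Finset.range k, c (θ^[i] ω) ≤ B - k * ε := by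
  -- Half of the mean: c + ε still has negative mean, and boundedness of its Birkhoff sums is the
  -- asserted drift of c.
  set ε := -(∫ ω, c ω ∂P) / 2 with hε
  have hεpos : 0 < ε := by rw [hε]; linarith
  refine ⟨ε, hεpos, ?_⟩
  set f : Ω → ℝ := fun ω => c ω + ε with hf
  have hfi : Integrable f P := hc.add (integrable_const _)
  have hfm : Measurable f := hcm.add measurable_const
  have hfneg : ∫ ω, f ω ∂P < 0 := by
    rw [hf, integral_add hc (integrable_const _)]
    simp [hε]; linarith
  have hmeas := fun n => measurable_maxBirkhoff hθ.measurable hfm n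
  set F := maxBirkhoff θ f with hF
  have hFmono : ∀ ω, Monotone fun n => F n ω :=
    fun ω => monotone_nat_of_le_succ fun n => maxBirkhoff_le_succ θ f n ω
  set G : Set Ω := {ω | BddAbove (range fun n => F n ω)} with hG
  have hGm : MeasurableSet G := measurableSet_bddAbove_range hmeas
  have hGinv : θ ⁻¹' G = G := by
    ext ω
    constructor
    · rintro ⟨b, hb⟩
      refine ⟨max 0 (f ω + b), ?_⟩
      rintro _ ⟨n, rfl⟩
      refine (maxBirkhoff_le_succ θ f n ω).trans ?_
      exact max_le_max le_rfl (add_le_add le_rfl (hb ⟨n, rfl⟩))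
    · rintro ⟨b, hb⟩
      refine ⟨b - f ω, ?_⟩
      rintro _ ⟨n, rfl⟩
      have h1 : F (n + 1) ω ≤ b := hb ⟨n + 1, rfl⟩
      have h2 : f ω + F n (θ ω) ≤ F (n + 1) ω := le_max_right _ _
      simp only
      linarith
  -- The set G is strictly invariant, so it has full or zero measure. In the latter case the sets {F
  -- n > 0} exhaust Ω up to a null set, and the maximal inequality would make the mean of f
  -- nonnegative.
  have hGfull : ∀ᵐ ω ∂P, ω ∈ G := by
    rcases hθ.toPreErgodic.ae_mem_or_ae_notMem hGm hGinv with h | h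
    · exact h
    · exfalso
      have hlim : Tendsto (fun n => ∫ ω in {ω | 0 < F n ω}, f ω ∂P) atTop
          (𝓝 (∫ ω in ⋃ n, {ω | 0 < F n ω}, f ω ∂P)) := by
        refine tendsto_setIntegral_of_monotone
          (fun n => measurableSet_lt measurable_const (hmeas n)) ?_ hfi.integrableOn
        intro n m hnm ω hω
        exact lt_of_lt_of_le hω (hFmono ω hnm)
      have h0 : 0 ≤ ∫ ω in ⋃ n, {ω | 0 < F n ω}, f ω ∂P :=
        ge_of_tendsto' hlim fun n => setIntegral_maxBirkhoff_nonneg hθ.toMeasurePreserving hfi hfm n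
      have heq : ∫ ω in ⋃ n, {ω | 0 < F n ω}, f ω ∂P = ∫ ω, f ω ∂P := by
        refine (setIntegral_congr_set ?_).trans setIntegral_univ
        rw [eventuallyEq_univ]
        filter_upwards [h] with ω hω
        by_contra hcon
        refine hω ⟨0, ?_⟩
        rintro _ ⟨n, rfl⟩
        refine not_lt.1 fun hn => hcon (mem_iUnion.2 ⟨n, hn⟩)
      linarith
  filter_upwards [hGfull] with ω hω
  obtain ⟨b, hb⟩ := hω
  refine ⟨b, (maxBirkhoff_nonneg θ f 0 ω).trans (hb ⟨0, rfl⟩), fun k => ?_⟩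
  have h1 := sum_le_maxBirkhoff θ f k ω
  have h2 : F k ω ≤ b := hb ⟨k, rfl⟩
  simp only [hf, Finset.sum_add_distrib, Finset.sum_const, Finset.card_range, nsmul_eq_mul] at h1
  linarith

/-! ### Connected sets, hitting events and measurable selection -/

/-- If a connected set is covered by finitely many balls of radius `ρ / 2` and `f` maps pairs of
points at distance `< ρ` to pairs at distance `≤ η`, then the image has small diameter. -/
theorem dist_le_of_isPreconnected_of_cover {X Y : Type*} [PseudoMetricSpace X]
    [PseudoMetricSpace Y] {S : Set X} (hS : IsPreconnected S) {t : Finset X} {ρ : ℝ}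
    (hcov : S ⊆ ⋃ p ∈ t, Metric.ball p (ρ / 2)) {f : X → Y} (hf : ContinuousOn f S) {η : ℝ}
    (hη : 0 ≤ η) (h : ∀ x ∈ S, ∀ y ∈ S, dist x y < ρ → dist (f x) (f y) ≤ η)
    {x y : X} (hx : x ∈ S) (hy : y ∈ S) : dist (f x) (f y) ≤ 2 * η * t.card := by
  classical
  set u : X → ℝ := fun z => dist (f z) (f y) with hu
  have hucont : ContinuousOn u S := fun z hz => (hf z hz).dist continuousWithinAt_const
  have hint : Icc (u y) (u x) ⊆ u '' S := hS.intermediate_value hy hx hucont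
  have huy : u y = 0 := dist_self _
  have hpiece : ∀ p ∈ t, ∃ z : ℝ,
      u '' (S ∩ Metric.ball p (ρ / 2)) ⊆ Icc (z - η) (z + η) := by
    intro p _
    rcases (S ∩ Metric.ball p (ρ / 2)).eq_empty_or_nonempty with he | ⟨z, hzS, hzp⟩
    · exact ⟨0, by simp [he]⟩
    · refine ⟨u z, ?_⟩
      rintro _ ⟨w, ⟨hwS, hwp⟩, rfl⟩
      have hd : dist w z < ρ := by
        have h1 := Metric.mem_ball.1 hwp
        have h2 := Metric.mem_ball'.1 hzp
        linarith [dist_triangle w p z]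
      have h3 := h w hwS z hzS hd
      have h4 : |u w - u z| ≤ dist (f w) (f z) := abs_dist_sub_le _ _ _
      have h5 := abs_le.1 (h4.trans h3)
      constructor <;> linarith [h5.1, h5.2]
  choose! z hz using hpiece
  -- By connectedness u takes all values in [0, u x], and each ball contributes only an interval of
  -- length 2η; comparing Lebesgue measures bounds u x.
  have hsub : Icc 0 (u x) ⊆ ⋃ p ∈ t, Icc (z p - η) (z p + η) := by
    rw [← huy]
    refine hint.trans ?_
    rintro _ ⟨w, hw, rfl⟩
    obtain ⟨p, hp, hwp⟩ := mem_iUnion₂.1 (hcov hw)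
    exact mem_iUnion₂.2 ⟨p, hp, hz p hp ⟨w, ⟨hw, hwp⟩, rfl⟩⟩
  have hvol : volume (Icc (0 : ℝ) (u x)) ≤ ENNReal.ofReal (2 * η * t.card) := by
    calc volume (Icc (0 : ℝ) (u x)) ≤ volume (⋃ p ∈ t, Icc (z p - η) (z p + η)) :=
          measure_mono hsub
      _ ≤ ∑ p ∈ t, volume (Icc (z p - η) (z p + η)) := measure_biUnion_finset_le _ _
      _ = ∑ p ∈ t, ENNReal.ofReal (2 * η) := by
          refine Finset.sum_congr rfl fun p _ => ?_
          rw [Real.volume_Icc]; congr 1; ring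
      _ = ENNReal.ofReal (2 * η * t.card) := by
          rw [Finset.sum_const, nsmul_eq_mul, mul_comm,
            ENNReal.ofReal_mul (p := 2 * η) (by positivity), ENNReal.ofReal_natCast]
  rw [Real.volume_Icc, sub_zero] at hvol
  exact (ENNReal.ofReal_le_ofReal_iff (by positivity)).1 hvol

/-- The event that a random compact set hits a closed set is measurable. -/
theorem measurableSet_inter_nonempty {Ω X : Type*} [MeasurableSpace Ω] [PseudoEMetricSpace X]
    [TopologicalSpace.SeparableSpace X] {Q : Ω → Set X} (hQ : ∀ ω, IsCompact (Q ω))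
    (hm : ∀ x ε, MeasurableSet {ω | Metric.infEDist x (Q ω) < ε}) {C : Set X} (hC : IsClosed C) :
    MeasurableSet {ω | (Q ω ∩ C).Nonempty} := by
  rcases isEmpty_or_nonempty X with hX | hX
  · have : {ω | (Q ω ∩ C).Nonempty} = ∅ := by
      ext ω; simp [Set.eq_empty_of_isEmpty]
    rw [this]; exact MeasurableSet.empty
  set x := TopologicalSpace.denseSeq X
  have hx : DenseRange x := TopologicalSpace.denseRange_denseSeq X
  -- Hitting C is equivalent to coming arbitrarily close to it, as Q ω is compact and C closed;
  -- closeness can be tested on a countable dense set.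
  have heq : {ω | (Q ω ∩ C).Nonempty} = ⋂ j : ℕ, ⋃ k : ℕ,
      {ω | Metric.infEDist (x k) (Q ω) < (j + 1 : ℝ≥0∞)⁻¹ ∧
        Metric.infEDist (x k) C < (j + 1 : ℝ≥0∞)⁻¹} := by
    ext ω
    simp only [mem_ofPred_eq, mem_iInter, mem_iUnion]
    constructor
    · rintro ⟨p, hpQ, hpC⟩ j
      have hpos : (0 : ℝ≥0∞) < (j + 1 : ℝ≥0∞)⁻¹ := by simp [ENNReal.inv_pos]
      obtain ⟨k, hk⟩ := hx.exists_mem_open Metric.isOpen_eball ⟨p, Metric.mem_eball_self hpos⟩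
      exact ⟨k, (Metric.infEDist_le_edist_of_mem hpQ).trans_lt hk,
        (Metric.infEDist_le_edist_of_mem hpC).trans_lt hk⟩
    · intro h
      have hp : ∀ j : ℕ, ∃ p ∈ Q ω,
          Metric.infEDist p C ≤ (j + 1 : ℝ≥0∞)⁻¹ + (j + 1 : ℝ≥0∞)⁻¹ := by
        intro j
        obtain ⟨k, h1, h2⟩ := h j
        obtain ⟨p, hpQ, hp⟩ := Metric.infEDist_lt_iff.1 h1
        refine ⟨p, hpQ, ?_⟩
        refine (Metric.infEDist_le_infEDist_add_edist (y := x k)).trans ?_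
        rw [edist_comm]
        exact add_le_add h2.le hp.le
      obtain ⟨p0, hp0, _⟩ := hp 0
      obtain ⟨q, hqQ, hq⟩ := (hQ ω).exists_isMinOn ⟨p0, hp0⟩
        (Metric.continuous_infEDist (s := C)).continuousOn
      refine ⟨q, hqQ, ?_⟩
      have h0 : Metric.infEDist q C ≤ 0 := by
        have hlim : Tendsto (fun j : ℕ => (j + 1 : ℝ≥0∞)⁻¹ + (j + 1 : ℝ≥0∞)⁻¹) atTop (𝓝 0) := by
          have h1 : Tendsto (fun j : ℕ => (j + 1 : ℝ≥0∞)⁻¹) atTop (𝓝 0) := by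
            have := (tendsto_add_atTop_iff_nat 1).2 ENNReal.tendsto_inv_nat_nhds_zero
            simpa using this
          simpa using h1.add h1
        refine ge_of_tendsto' hlim fun j => ?_
        obtain ⟨p, hpQ, hp'⟩ := hp j
        exact (hq hpQ).trans hp'
      exact (Metric.mem_iff_infEDist_zero_of_closed hC).2 (nonpos_iff_eq_zero.1 h0)
  rw [heq]
  refine MeasurableSet.iInter fun j => MeasurableSet.iUnion fun k => ?_
  exact (hm _ _).inter (MeasurableSet.const _)

/-- A measurable upper bound for a bounded random continuous function on a random open set,
together with a measurable almost maximizer. -/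
theorem exists_measurable_sup_and_selection {Ω M : Type*} [MeasurableSpace Ω] [TopologicalSpace M]
    [TopologicalSpace.SeparableSpace M] [Nonempty M] [MeasurableSpace M] {U : Set (Ω × M)}
    (hUm : ∀ x, MeasurableSet {ω | (ω, x) ∈ U}) (hUo : ∀ ω, IsOpen {x | (ω, x) ∈ U})
    {φ : Ω × M → ℝ} (hφm : ∀ x, Measurable fun ω => φ (ω, x))
    (hφc : ∀ ω, Continuous fun x => φ (ω, x)) {a b : ℝ} (ha : ∀ p, a ≤ φ p) (hb : ∀ p, φ p ≤ b) :
    ∃ c : Ω → ℝ, Measurable c ∧ (∀ ω, a ≤ c ω ∧ c ω ≤ b) ∧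
      (∀ ω x, (ω, x) ∈ U → φ (ω, x) ≤ c ω) ∧
      ∃ s : Ω → M, Measurable s ∧
        ∀ ω, (∃ x, (ω, x) ∈ U) → (ω, s ω) ∈ U ∧ c ω - 1 < φ (ω, s ω) := by
  classical
  set x := TopologicalSpace.denseSeq M
  have hx : DenseRange x := TopologicalSpace.denseRange_denseSeq M
  -- The default value a is a lower bound of φ, so points outside U do not raise the supremum above
  -- that over U when the section of U is nonempty.
  set ψ : ℕ → Ω → ℝ := fun k ω => if (ω, x k) ∈ U then φ (ω, x k) else a with hψ
  have hψm : ∀ k, Measurable (ψ k) := fun k =>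
    Measurable.ite (hUm (x k)) (hφm (x k)) measurable_const
  have hψb : ∀ k ω, a ≤ ψ k ω ∧ ψ k ω ≤ b := by
    intro k ω
    simp only [hψ]
    split_ifs
    · exact ⟨ha _, hb _⟩
    · exact ⟨le_rfl, (ha (ω, x 0)).trans (hb _)⟩
  have hbdd : ∀ ω, BddAbove (range fun k => ψ k ω) :=
    fun ω => ⟨b, by rintro _ ⟨k, rfl⟩; exact (hψb k ω).2⟩
  refine ⟨fun ω => ⨆ k, ψ k ω, Measurable.iSup hψm,
    fun ω => ⟨(hψb 0 ω).1.trans (le_ciSup (hbdd ω) 0), ciSup_le fun k => (hψb k ω).2⟩, ?_, ?_⟩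
  · intro ω p hp
    refine le_of_forall_lt fun t ht => ?_
    obtain ⟨k, hkU, hkt⟩ := hx.exists_mem_open
      ((hUo ω).inter (isOpen_lt continuous_const (hφc ω))) ⟨p, hp, ht⟩
    have hkU' : (ω, x k) ∈ U := hkU
    refine lt_of_lt_of_le (b := ψ k ω) ?_ (le_ciSup (hbdd ω) k)
    simp only [hψ, if_pos hkU']
    exact hkt
  · set good : ℕ → Ω → Prop := fun k ω => (ω, x k) ∈ U ∧ (⨆ k, ψ k ω) - 1 < φ (ω, x k)
    have hgood : ∀ k, MeasurableSet {ω | good k ω} := fun k =>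
      (hUm (x k)).inter (measurableSet_lt ((Measurable.iSup hψm).sub_const 1) (hφm (x k)))
    -- The second alternative makes the search for the first good index succeed at every ω.
    have hex : ∀ ω, ∃ k, good k ω ∨ ∀ l, ¬ good l ω := by
      intro ω
      by_cases h : ∃ k, good k ω
      · exact h.imp fun k hk => Or.inl hk
      · exact ⟨0, Or.inr (not_exists.1 h)⟩
    refine ⟨fun ω => x (Nat.find (hex ω)),
      Measurable.find (f := fun k _ => x k) (fun k => measurable_const) (fun k => ?_) hex, ?_⟩
    · have : {ω | ∀ l, ¬ good l ω} = ⋂ l, {ω | good l ω}ᶜ := by ext ω; simp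
      have hm : MeasurableSet {ω | ∀ l, ¬ good l ω} :=
        this ▸ MeasurableSet.iInter fun l => (hgood l).compl
      exact (hgood k).union hm
    · rintro ω ⟨p, hp⟩
      rcases Nat.find_spec (hex ω) with h | h
      · exact h
      · exfalso
        obtain ⟨l, hl⟩ := exists_lt_of_lt_ciSup (sub_one_lt (⨆ k, ψ k ω))
        by_cases hlU : (ω, x l) ∈ U
        · refine h l ⟨hlU, ?_⟩
          simpa only [hψ, if_pos hlU] using hl
        · obtain ⟨k, hkU⟩ := hx.exists_mem_open (hUo ω) ⟨p, hp⟩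
          have hkU' : (ω, x k) ∈ U := hkU
          refine h k ⟨hkU', lt_of_lt_of_le hl ?_⟩
          simp only [hψ, if_neg hlU]
          exact ha _

/-! ### Weak limits of random measures over a base without topology -/

section WeakLimits

open scoped unitInterval

/-- Convergence in the compact-open topology is uniform on compact sets. Test functions with values
in the unit interval stay bounded on all of M, even away from Q. -/
theorem exists_forall_dist_lt_of_isCompact {M : Type*} [TopologicalSpace M]
    {F : ℕ → C(M, I)} (hF : DenseRange F) {Q : Set M} (hQ : IsCompact Q) (f : C(M, I)) {ε : ℝ}
    (hε : 0 < ε) : ∃ j, ∀ x ∈ Q, |(f x : ℝ) - F j x| < ε := by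
  have h1 : ∀ᶠ g : C(M, I) in 𝓝 f, ∀ x ∈ Q, dist (f x) (g x) < ε :=
    Metric.tendstoUniformlyOn_iff.1
      (ContinuousMap.tendsto_iff_forall_isCompact_tendstoUniformlyOn.1
        (tendsto_id (x := 𝓝 f)) Q hQ) ε hε
  obtain ⟨g, ⟨j, rfl⟩, hg⟩ := ((mem_closure_iff_frequently.1 (hF f)).and_eventually h1).exists
  exact ⟨j, fun x hx => by simpa [Subtype.dist_eq, Real.dist_eq] using hg x hx⟩

theorem integrable_unitInterval {M : Type*} [TopologicalSpace M] [MeasurableSpace M]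
    [OpensMeasurableSpace M] (μ : Measure M) [IsFiniteMeasure μ] (f : C(M, I)) :
    Integrable (fun x => (f x : ℝ)) μ := by
  refine Integrable.of_bound (C := 1)
    (continuous_subtype_val.comp f.continuous).measurable.aestronglyMeasurable
    (ae_of_all _ fun x => ?_)
  rw [Real.norm_eq_abs, abs_of_nonneg (f x).2.1]
  exact (f x).2.2

/-- Probability measures carried by a common compact set converge weakly as soon as the integrals
of a dense sequence of test functions converge. -/
theorem exists_tendsto_probabilityMeasure {M : Type*} [TopologicalSpace M] [T2Space M]
    [MeasurableSpace M] [BorelSpace M] [HasOuterApproxClosed M] {F : ℕ → C(M, I)}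
    (hF : DenseRange F) {Q : Set M} (hQ : IsCompact Q) (μ : ℕ → ProbabilityMeasure M)
    (hμ : ∀ n, (μ n : Measure M) Qᶜ = 0)
    (hconv : ∀ j, ∃ l, Tendsto (fun n => ∫ x, (F j x : ℝ) ∂(μ n : Measure M)) atTop (𝓝 l)) :
    ∃ ν : ProbabilityMeasure M, Tendsto μ atTop (𝓝 ν) := by
  have hunit : ∀ f : C(M, I), ∃ l,
      Tendsto (fun n => ∫ x, (f x : ℝ) ∂(μ n : Measure M)) atTop (𝓝 l) := by
    intro f
    refine cauchySeq_tendsto_of_complete (Metric.cauchySeq_iff'.2 fun ε hε => ?_)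
    obtain ⟨j, hj⟩ := exists_forall_dist_lt_of_isCompact hF hQ f
      (show 0 < ε / 3 by positivity)
    have hclose : ∀ n, |∫ x, (f x : ℝ) ∂(μ n : Measure M) -
        ∫ x, (F j x : ℝ) ∂(μ n : Measure M)| ≤ ε / 3 := by
      intro n
      rw [← integral_sub (integrable_unitInterval _ f) (integrable_unitInterval _ (F j))]
      have := norm_integral_le_of_norm_le_const (μ := (μ n : Measure M)) (C := ε / 3)
        (f := fun x => (f x : ℝ) - F j x) (by
          have : ∀ᵐ x ∂(μ n : Measure M), x ∈ Q := by
            rw [ae_iff]; exact hμ n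
          filter_upwards [this] with x hx
          exact (hj x hx).le)
      simpa using this
    obtain ⟨l, hl⟩ := hconv j
    obtain ⟨N, hN⟩ := Metric.cauchySeq_iff'.1 hl.cauchySeq (ε / 3) (by positivity)
    refine ⟨N, fun n hn => ?_⟩
    have h1 := abs_le.1 (hclose n)
    have h2 := abs_le.1 (hclose N)
    have h3 := abs_lt.1 (hN n hn)
    rw [Real.dist_eq, abs_lt]
    constructor <;> linarith [h1.1, h1.2, h2.1, h2.2, h3.1, h3.2]
  have hbdd : ∀ f : M →ᵇ ℝ, ∃ l,
      Tendsto (fun n => ∫ x, f x ∂(μ n : Measure M)) atTop (𝓝 l) := by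
    intro f
    set B := ‖f‖ + 1 with hB
    have hBpos : 0 < B := by positivity
    have hfB : ∀ x, -B ≤ f x ∧ f x ≤ B := fun x => by
      have := abs_le.1 ((Real.norm_eq_abs (f x)) ▸ f.norm_coe_le_norm x)
      constructor <;> linarith [this.1, this.2]
    let g : C(M, I) := ⟨fun x => ⟨(f x + B) / (2 * B), by
        have := hfB x
        constructor
        · apply div_nonneg <;> linarith [this.1]
        · rw [div_le_one (by positivity)]; linarith [this.2]⟩, by
      refine Continuous.subtype_mk ?_ _
      exact (f.continuous.add continuous_const).div_const _⟩
    obtain ⟨l, hl⟩ := hunit g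
    refine ⟨2 * B * l - B, ?_⟩
    refine ((hl.const_mul (2 * B)).sub_const B).congr fun n => ?_
    have : ∀ x, f x = 2 * B * (g x : ℝ) - B := fun x => by
      change f x = 2 * B * ((f x + B) / (2 * B)) - B
      field_simp; ring
    simp_rw [this]
    rw [integral_sub ((integrable_unitInterval _ g).const_mul _) (integrable_const _),
      integral_const_mul]
    simp
  -- The common compact carrier gives tightness, hence relative compactness by Prokhorov's theorem;
  -- convergence of all integrals leaves only one cluster point.
  have htight : IsTightMeasureSet {((ν : ProbabilityMeasure M) : Measure M) | ν ∈ range μ} := by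
    rw [isTightMeasureSet_iff_exists_isCompact_measure_compl_le]
    intro ε _
    refine ⟨Q, hQ, ?_⟩
    rintro _ ⟨_, ⟨n, rfl⟩, rfl⟩
    simp [hμ n]
  have hcomp := isCompact_closure_of_isTightMeasureSet htight
  have hmem : ∀ n, μ n ∈ closure (range μ) := fun n => subset_closure ⟨n, rfl⟩
  have hclu : ∀ ν, MapClusterPt ν atTop μ → ∀ (f : M →ᵇ ℝ) (l : ℝ),
      Tendsto (fun n => ∫ x, f x ∂(μ n : Measure M)) atTop (𝓝 l) →
      ∫ x, f x ∂(ν : Measure M) = l := by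
    intro ν hν f l hl
    obtain ⟨U, hU, hUν⟩ := mapClusterPt_iff_ultrafilter.1 hν
    exact tendsto_nhds_unique
      (ProbabilityMeasure.tendsto_iff_forall_integral_tendsto.1 hUν f) (hl.mono_left hU)
  obtain ⟨ν, _, hν⟩ := hcomp.exists_mapClusterPt (f := atTop) (u := μ)
    (by rw [le_principal_iff]; exact Filter.mem_map.2 (univ_mem' hmem))
  refine ⟨ν, hcomp.tendsto_nhds_of_unique_mapClusterPt (Eventually.of_forall hmem) ?_⟩
  intro ν' _ hν'
  have h1 : IsProbabilityMeasure (ν' : Measure M) := ν'.2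
  have h2 : IsProbabilityMeasure (ν : Measure M) := ν.2
  refine Subtype.ext (ext_of_forall_integral_eq_of_IsFiniteMeasure
    (μ := (ν' : Measure M)) (ν := (ν : Measure M)) fun f => ?_)
  obtain ⟨l, hl⟩ := hbdd f
  exact (hclu ν' hν' f l hl).trans (hclu ν hν f l hl).symm

/-- A family of probability measures is measurable if it is a pointwise weak limit of measurable
families. -/
theorem measurable_of_tendsto_probabilityMeasure {Ω M : Type*} [MeasurableSpace Ω]
    [TopologicalSpace M] [MeasurableSpace M] [BorelSpace M] [HasOuterApproxClosed M]
    (κ : ℕ → Ω → ProbabilityMeasure M) (hκ : ∀ n, Measurable fun ω => (κ n ω : Measure M))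
    (ν : Ω → ProbabilityMeasure M) (hν : ∀ ω, Tendsto (fun n => κ n ω) atTop (𝓝 (ν ω))) :
    Measurable fun ω => (ν ω : Measure M) := by
  refine Measurable.measure_of_isPiSystem_of_isProbabilityMeasure
    (by rw [BorelSpace.measurable_eq (α := M), borel_eq_generateFrom_isClosed])
    isPiSystem_isClosed fun C hC => ?_
  have hC' : IsClosed C := hC
  have h1 : ∀ f : M →ᵇ ℝ≥0, Measurable fun ω => ∫⁻ x, f x ∂(ν ω : Measure M) := by
    intro f
    refine measurable_of_tendsto_metrizable
      (f := fun n ω => ∫⁻ x, f x ∂(κ n ω : Measure M)) (fun n => ?_) ?_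
    · exact (Measure.measurable_lintegral
        (ENNReal.continuous_coe.comp f.continuous).measurable).comp (hκ n)
    · exact tendsto_pi_nhds.2 fun ω =>
        ProbabilityMeasure.tendsto_iff_forall_lintegral_tendsto.1 (hν ω) f
  refine measurable_of_tendsto_metrizable
    (f := fun n ω => ∫⁻ x, hC'.apprSeq n x ∂(ν ω : Measure M)) (fun n => h1 _) ?_
  exact tendsto_pi_nhds.2 fun ω => HasOuterApproxClosed.tendsto_lintegral_apprSeq hC' _

/-- Sequential compactness for random probability measures without topology on the base: from a
decreasing sequence of nonempty sets of Markov kernels that are closed under midpoints and carried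
by a random compact set, one can select a sequence that converges weakly almost everywhere. -/
theorem exists_ae_tendsto_kernel {Ω M : Type*} [MeasurableSpace Ω] (P : Measure Ω)
    [IsProbabilityMeasure P] [TopologicalSpace M] [T2Space M] [SecondCountableTopology M]
    [LocallyCompactSpace M] [MeasurableSpace M] [BorelSpace M] [HasOuterApproxClosed M]
    [Nonempty M] (S : ℕ → Set (Kernel Ω M)) (hanti : Antitone S) (hne : ∀ n, (S n).Nonempty)
    (hmarkov : ∀ κ ∈ S 0, IsMarkovKernel κ)
    (hmid : ∀ n, ∀ κ ∈ S n, ∀ κ' ∈ S n, ∃ κ'' ∈ S n, ∀ ω, κ'' ω = (2⁻¹ : ℝ≥0∞) • (κ ω + κ' ω))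
    {Q : Ω → Set M} (hQ : ∀ ω, IsCompact (Q ω))
    (hsupp : ∀ κ ∈ S 0, ∀ᵐ ω ∂P, κ ω (Q ω)ᶜ = 0) :
    ∃ (κ : ℕ → Kernel Ω M) (κ' : Kernel Ω M), IsMarkovKernel κ' ∧ (∀ n, κ n ∈ S n) ∧
      ∀ᵐ ω ∂P, ∀ f : M →ᵇ ℝ,
        Tendsto (fun n => ∫ x, f x ∂(κ n ω)) atTop (𝓝 (∫ x, f x ∂(κ' ω))) := by
  classical
  set F : ℕ → C(M, I) := TopologicalSpace.denseSeq C(M, I) with hFdef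
  have hF : DenseRange F := TopologicalSpace.denseRange_denseSeq _
  have hS0 : ∀ n, ∀ κ ∈ S n, IsMarkovKernel κ := fun n κ hκ => hmarkov κ (hanti n.zero_le hκ)
  -- A finite measure with the null sets of counting measure. A kernel is encoded by its integrals
  -- against the F j as an element of L² of P.prod ν, and this encoding respects midpoints.
  set ν : Measure ℕ := (Measure.count : Measure ℕ).toFinite with hνdef
  have hνae : ∀ p : ℕ → Prop, (∀ᵐ j ∂ν, p j) → ∀ j, p j := by
    intro p hp
    rw [hνdef, ae_toFinite] at hp
    exact Measure.ae_count_iff.1 hp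
  let v : Kernel Ω M → Ω × ℕ → ℝ := fun κ p => ∫ x, (F p.2 x : ℝ) ∂(κ p.1)
  have hv01 : ∀ κ, IsMarkovKernel κ → ∀ p, 0 ≤ v κ p ∧ v κ p ≤ 1 := by
    intro κ hκ p
    refine ⟨integral_nonneg fun x => (F p.2 x).2.1, ?_⟩
    calc v κ p ≤ ∫ x, (1 : ℝ) ∂(κ p.1) :=
          integral_mono (integrable_unitInterval _ _) (integrable_const _) fun x => (F p.2 x).2.2
      _ = 1 := by simp
  have hvm : ∀ κ, IsMarkovKernel κ → Measurable (v κ) := by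
    intro κ hκ
    refine measurable_from_prod_countable_left fun j => ?_
    exact (StronglyMeasurable.integral_kernel
      (continuous_subtype_val.comp (F j).continuous).measurable.stronglyMeasurable).measurable
  have hvL : ∀ κ, IsMarkovKernel κ → MemLp (v κ) 2 (P.prod ν) := by
    intro κ hκ
    refine MemLp.of_bound (hvm κ hκ).aestronglyMeasurable 1 (ae_of_all _ fun p => ?_)
    rw [Real.norm_eq_abs, abs_of_nonneg (hv01 κ hκ p).1]
    exact (hv01 κ hκ p).2
  let V : Kernel Ω M → Lp ℝ 2 (P.prod ν) :=
    fun κ => if h : MemLp (v κ) 2 (P.prod ν) then h.toLp (v κ) else 0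
  have hV : ∀ κ, IsMarkovKernel κ → V κ =ᵐ[P.prod ν] v κ := by
    intro κ hκ
    simp only [V, dif_pos (hvL κ hκ)]
    exact MemLp.coeFn_toLp _
  obtain ⟨s, hs, hcau⟩ := exists_cauchySeq_of_midpoint V S hanti hne (by
      intro n κ hκ κ' hκ'
      obtain ⟨κ'', h'', hmid''⟩ := hmid n κ hκ κ' hκ'
      refine ⟨κ'', h'', ?_⟩
      have := hS0 n κ hκ
      have := hS0 n κ' hκ'
      have := hS0 n κ'' h''
      refine Lp.ext ?_
      filter_upwards [hV κ inferInstance, hV κ' inferInstance, hV κ'' inferInstance,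
        Lp.coeFn_smul (1 / 2 : ℝ) (V κ + V κ'), Lp.coeFn_add (V κ) (V κ')] with p h1 h2 h3 h4 h5
      rw [h4, Pi.smul_apply, h5, Pi.add_apply, h1, h2, h3]
      simp only [v, hmid'']
      rw [integral_smul_measure, integral_add_measure (integrable_unitInterval _ _)
        (integrable_unitInterval _ _)]
      simp)
    (B := measureUnivNNReal (P.prod ν) ^ (2 : ℝ≥0∞).toReal⁻¹ * 1) (by
      intro κ hκ
      have := hmarkov κ hκ
      refine Lp.norm_le_of_ae_bound zero_le_one ?_
      filter_upwards [hV κ inferInstance] with p hp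
      rw [hp, Real.norm_eq_abs, abs_of_nonneg (hv01 κ inferInstance p).1]
      exact (hv01 κ inferInstance p).2)
  obtain ⟨g, hg⟩ := cauchySeq_tendsto_of_complete hcau
  -- Passing from L² convergence to almost everywhere convergence along a subsequence makes, over
  -- almost every ω, the integrals of all F j converge at once.
  obtain ⟨ns, hns, hae⟩ := (tendstoInMeasure_of_tendsto_Lp hg).exists_seq_tendsto_ae
  have hmk : ∀ n, IsMarkovKernel (s n) := fun n => hS0 n _ (hs n)
  have hconv : ∀ᵐ ω ∂P, ∀ j, Tendsto (fun i => v (s (ns i)) (ω, j)) atTop (𝓝 (g (ω, j))) := by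
    have h1 : ∀ᵐ p ∂(P.prod ν), Tendsto (fun i => v (s (ns i)) p) atTop (𝓝 (g p)) := by
      have h2 : ∀ᵐ p ∂(P.prod ν), ∀ i, V (s (ns i)) p = v (s (ns i)) p :=
        ae_all_iff.2 fun i => hV _ (hmk _)
      filter_upwards [hae, h2] with p hp h2p
      simpa only [h2p] using hp
    filter_upwards [Measure.ae_ae_of_ae_prod h1] with ω hω
    exact hνae _ hω
  have hsup : ∀ᵐ ω ∂P, ∀ i, s (ns i) ω (Q ω)ᶜ = 0 :=
    ae_all_iff.2 fun i => hsupp _ (hanti (Nat.zero_le _) (hs _))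
  let μ : ℕ → Ω → ProbabilityMeasure M := fun i ω => ⟨s (ns i) ω, (hmk _).isProbabilityMeasure ω⟩
  have hgood : ∀ᵐ ω ∂P, ∃ l : ProbabilityMeasure M, Tendsto (fun i => μ i ω) atTop (𝓝 l) := by
    filter_upwards [hconv, hsup] with ω h1 h2
    exact exists_tendsto_probabilityMeasure hF (hQ ω) (fun i => μ i ω) h2 fun j => ⟨_, h1 j⟩
  obtain ⟨G, hGsub, hGm, hGae⟩ : ∃ G : Set Ω,
      (∀ ω ∈ G, ∃ l : ProbabilityMeasure M, Tendsto (fun i => μ i ω) atTop (𝓝 l)) ∧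
      MeasurableSet G ∧ ∀ᵐ ω ∂P, ω ∈ G := by
    obtain ⟨t, hst, htm, ht⟩ := exists_measurable_superset_of_null (ae_iff.1 hgood)
    refine ⟨tᶜ, fun ω hω => by_contra fun h => hω (hst h), htm.compl, ?_⟩
    rw [ae_iff]
    simpa using ht
  let x₀ : ProbabilityMeasure M := ⟨Measure.dirac (Classical.arbitrary M), inferInstance⟩
  have : Nonempty (ProbabilityMeasure M) := ⟨x₀⟩
  choose! l hl using hGsub
  -- A fixed Dirac measure off G makes the sequence converge at every ω, so that the limit is a
  -- measurable kernel.
  let μ' : ℕ → Ω → ProbabilityMeasure M := fun i ω => if ω ∈ G then μ i ω else x₀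
  let l' : Ω → ProbabilityMeasure M := fun ω => if ω ∈ G then l ω else x₀
  have hl' : ∀ ω, Tendsto (fun i => μ' i ω) atTop (𝓝 (l' ω)) := by
    intro ω
    by_cases hω : ω ∈ G
    · simpa only [μ', l', if_pos hω] using hl ω hω
    · simp only [μ', l', if_neg hω]; exact tendsto_const_nhds
  have hμ'm : ∀ i, Measurable fun ω => (μ' i ω : Measure M) := by
    intro i
    have : (fun ω => (μ' i ω : Measure M)) =
        fun ω => if ω ∈ G then s (ns i) ω else (x₀ : Measure M) := by
      funext ω
      by_cases hω : ω ∈ G <;> simp [μ', hω, μ]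
    rw [this]
    exact Measurable.ite hGm (s (ns i)).measurable measurable_const
  refine ⟨fun i => s (ns i), ⟨fun ω => l' ω,
    measurable_of_tendsto_probabilityMeasure μ' hμ'm l' hl'⟩, ⟨fun ω => (l' ω).2⟩,
    fun n => hanti (hns.id_le n) (hs _), ?_⟩
  filter_upwards [hGae] with ω hω f
  have := ProbabilityMeasure.tendsto_iff_forall_integral_tendsto.1 (hl' ω) f
  simp only [μ', if_pos hω] at this
  exact this

end WeakLimits

/-! ### Iterates and the derivative cocycle -/

namespace DoubleSkewProduct

variable {Ω : Type*} [MeasurableSpace Ω] {P : Measure Ω} {Ξ : Type*} [MetricSpace Ξ]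
  [MeasurableSpace Ξ] {d : ℕ}

/-- The `Ξ`-component of the iterates of the skew product. -/
def gIter (T : DoubleSkewProduct P Ξ d) : ℕ → Ω → Ξ → Ξ
  | 0 => fun _ ξ => ξ
  | n + 1 => fun ω ξ => T.g (T.θ^[n] ω) (T.gIter n ω ξ)

theorem map_iterate_fst (T : DoubleSkewProduct P Ξ d) (n : ℕ)
    (x : Ω × Ξ × EuclideanSpace ℝ (Fin d)) : (T.map^[n] x).1 = T.θ^[n] x.1 := by
  induction n with
  | zero => rfl
  | succ n ih => rw [Function.iterate_succ_apply', Function.iterate_succ_apply', ← ih]; rfl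

theorem map_iterate_snd_fst (T : DoubleSkewProduct P Ξ d) (n : ℕ) (ω : Ω) (ξ : Ξ)
    (y : EuclideanSpace ℝ (Fin d)) : (T.map^[n] (ω, ξ, y)).2.1 = T.gIter n ω ξ := by
  induction n with
  | zero => rfl
  | succ n ih =>
    change _ = T.g (T.θ^[n] ω) (T.gIter n ω ξ)
    rw [Function.iterate_succ_apply', ← ih, ← T.map_iterate_fst n (ω, ξ, y)]; rfl

theorem map_iterate (T : DoubleSkewProduct P Ξ d) (n : ℕ) (ω : Ω) (ξ : Ξ)
    (y : EuclideanSpace ℝ (Fin d)) :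
    T.map^[n] (ω, ξ, y) = (T.θ^[n] ω, T.gIter n ω ξ, T.hIter n ω ξ y) :=
  Prod.ext (T.map_iterate_fst n _) (Prod.ext (T.map_iterate_snd_fst n ω ξ y) rfl)

theorem gIter_injective (T : DoubleSkewProduct P Ξ d) (n : ℕ) (ω : Ω) :
    Function.Injective (T.gIter n ω) := by
  induction n with
  | zero => exact fun _ _ h => h
  | succ n ih => exact (T.g _).injective.comp ih

theorem continuous_gIter (T : DoubleSkewProduct P Ξ d) (n : ℕ) (ω : Ω) :
    Continuous (T.gIter n ω) := by
  induction n with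
  | zero => exact continuous_id
  | succ n ih => exact (T.g _).continuous.comp ih

theorem hIter_succ (T : DoubleSkewProduct P Ξ d) (n : ℕ) (ω : Ω) (ξ : Ξ)
    (y : EuclideanSpace ℝ (Fin d)) :
    T.hIter (n + 1) ω ξ y = T.h (T.θ^[n] ω) (T.gIter n ω ξ) (T.hIter n ω ξ y) := by
  rw [hIter, Function.iterate_succ_apply', map_iterate]; rfl

theorem hIter_add (T : DoubleSkewProduct P Ξ d) (k l : ℕ) (ω : Ω) (ξ : Ξ)
    (y : EuclideanSpace ℝ (Fin d)) :
    T.hIter (k + l) ω ξ y = T.hIter l (T.θ^[k] ω) (T.gIter k ω ξ) (T.hIter k ω ξ y) := by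
  rw [hIter, add_comm, Function.iterate_add_apply, map_iterate T k]; rfl

theorem differentiable_hIter (T : DoubleSkewProduct P Ξ d) (n : ℕ) (ω : Ω) (ξ : Ξ) :
    Differentiable ℝ (T.hIter n ω ξ) := by
  induction n with
  | zero => exact differentiable_id
  | succ n ih =>
    have : T.hIter (n + 1) ω ξ =
        fun y => T.h (T.θ^[n] ω) (T.gIter n ω ξ) (T.hIter n ω ξ y) :=
      funext fun y => T.hIter_succ n ω ξ y
    rw [this]
    exact (T.differentiable_h _ _).comp ih

theorem continuous_hIter (T : DoubleSkewProduct P Ξ d) (n : ℕ) (ω : Ω) :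
    Continuous fun p : Ξ × EuclideanSpace ℝ (Fin d) => T.hIter n ω p.1 p.2 := by
  induction n with
  | zero => exact continuous_snd
  | succ n ih =>
    simp_rw [hIter_succ]
    exact (T.continuous_h (T.θ^[n] ω)).comp
      (((T.continuous_gIter n ω).comp continuous_fst).prodMk ih)

theorem fderiv_hIter_add (T : DoubleSkewProduct P Ξ d) (k l : ℕ) (ω : Ω) (ξ : Ξ)
    (y : EuclideanSpace ℝ (Fin d)) :
    fderiv ℝ (T.hIter (k + l) ω ξ) y =
      (fderiv ℝ (T.hIter l (T.θ^[k] ω) (T.gIter k ω ξ)) (T.hIter k ω ξ y)).comp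
        (fderiv ℝ (T.hIter k ω ξ) y) := by
  have : T.hIter (k + l) ω ξ = T.hIter l (T.θ^[k] ω) (T.gIter k ω ξ) ∘ T.hIter k ω ξ :=
    funext fun y => T.hIter_add k l ω ξ y
  rw [this]
  exact fderiv_comp y (T.differentiable_hIter l _ _ _) (T.differentiable_hIter k ω ξ y)

theorem continuous_fderiv_hIter (T : DoubleSkewProduct P Ξ d) (n : ℕ) (ω : Ω) :
    Continuous fun p : Ξ × EuclideanSpace ℝ (Fin d) => fderiv ℝ (T.hIter n ω p.1) p.2 := by
  induction n with
  | zero =>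
    have : ∀ p : Ξ × EuclideanSpace ℝ (Fin d), fderiv ℝ (T.hIter 0 ω p.1) p.2 =
        ContinuousLinearMap.id ℝ _ := fun p => fderiv_id
    simp_rw [this]
    exact continuous_const
  | succ n ih =>
    simp_rw [T.fderiv_hIter_add n 1]
    refine Continuous.clm_comp ?_ ih
    exact (T.continuous_fderiv_h (T.θ^[n] ω)).comp
      (((T.continuous_gIter n ω).comp continuous_fst).prodMk (T.continuous_hIter n ω))

theorem continuous_map_iterate_snd (T : DoubleSkewProduct P Ξ d) (n : ℕ) (ω : Ω) :
    Continuous fun p : Ξ × EuclideanSpace ℝ (Fin d) => (T.map^[n] (ω, p)).2 := by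
  have : (fun p : Ξ × EuclideanSpace ℝ (Fin d) => (T.map^[n] (ω, p)).2) =
      fun p => (T.gIter n ω p.1, T.hIter n ω p.1 p.2) := by
    funext p
    rw [show (ω, p) = (ω, p.1, p.2) from rfl, map_iterate]
  rw [this]
  exact ((T.continuous_gIter n ω).comp continuous_fst).prodMk (T.continuous_hIter n ω)

/-- The norm of the derivative of the `n`-th iterate in the fibre direction. -/
noncomputable def jac (T : DoubleSkewProduct P Ξ d) (n : ℕ)
    (x : Ω × Ξ × EuclideanSpace ℝ (Fin d)) : ℝ :=
  ‖fderiv ℝ (T.hIter n x.1 x.2.1) x.2.2‖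

theorem jac_nonneg (T : DoubleSkewProduct P Ξ d) (n : ℕ)
    (x : Ω × Ξ × EuclideanSpace ℝ (Fin d)) : 0 ≤ T.jac n x := norm_nonneg _

theorem jac_zero_le (T : DoubleSkewProduct P Ξ d) (x : Ω × Ξ × EuclideanSpace ℝ (Fin d)) :
    T.jac 0 x ≤ 1 := by
  have : fderiv ℝ (T.hIter 0 x.1 x.2.1) x.2.2 = ContinuousLinearMap.id ℝ _ := fderiv_id
  rw [jac, this]
  exact ContinuousLinearMap.norm_id_le

theorem jac_add_le (T : DoubleSkewProduct P Ξ d) (k l : ℕ)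
    (x : Ω × Ξ × EuclideanSpace ℝ (Fin d)) :
    T.jac (k + l) x ≤ T.jac l (T.map^[k] x) * T.jac k x := by
  obtain ⟨ω, ξ, y⟩ := x
  rw [map_iterate]
  simp only [jac]
  rw [fderiv_hIter_add]
  exact ContinuousLinearMap.opNorm_comp_le _ _

theorem continuous_jac (T : DoubleSkewProduct P Ξ d) (n : ℕ) (ω : Ω) :
    Continuous fun p : Ξ × EuclideanSpace ℝ (Fin d) => T.jac n (ω, p) :=
  (T.continuous_fderiv_hIter n ω).norm

theorem Phi_eq (T : DoubleSkewProduct P Ξ d) (n : ℕ)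
    (x : Ω × Ξ × EuclideanSpace ℝ (Fin d)) :
    T.Phi n x = ENNReal.log (ENNReal.ofReal (T.jac n x)) := by
  rw [Phi, jac, ofReal_norm]

theorem Phi_le_iff (T : DoubleSkewProduct P Ξ d) (n : ℕ) (x : Ω × Ξ × EuclideanSpace ℝ (Fin d))
    (C : ℝ) : T.Phi n x ≤ (C : EReal) ↔ T.jac n x ≤ Real.exp C := by
  have h : (C : EReal) = ENNReal.log (ENNReal.ofReal (Real.exp C)) := by
    rw [ENNReal.log_ofReal_of_pos (Real.exp_pos C), Real.log_exp]
  rw [Phi_eq, h, ENNReal.log_le_log_iff, ENNReal.ofReal_le_ofReal_iff (Real.exp_pos C).le]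

/-- The logarithm of the derivative norm, truncated to the interval `[-R, B]`. -/
noncomputable def logJac (T : DoubleSkewProduct P Ξ d) (R B : ℝ) (n : ℕ)
    (x : Ω × Ξ × EuclideanSpace ℝ (Fin d)) : ℝ :=
  Real.log (max (min (T.jac n x) (Real.exp B)) (Real.exp (-R)))

theorem exp_logJac (T : DoubleSkewProduct P Ξ d) (R B : ℝ) (n : ℕ)
    (x : Ω × Ξ × EuclideanSpace ℝ (Fin d)) :
    Real.exp (T.logJac R B n x) = max (min (T.jac n x) (Real.exp B)) (Real.exp (-R)) :=
  Real.exp_log (lt_max_of_lt_right (Real.exp_pos _))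

theorem neg_le_logJac (T : DoubleSkewProduct P Ξ d) (R B : ℝ) (n : ℕ)
    (x : Ω × Ξ × EuclideanSpace ℝ (Fin d)) : -R ≤ T.logJac R B n x := by
  rw [← Real.exp_le_exp, exp_logJac]; exact le_max_right _ _

theorem logJac_le (T : DoubleSkewProduct P Ξ d) {R B : ℝ} (h : -R ≤ B) (n : ℕ)
    (x : Ω × Ξ × EuclideanSpace ℝ (Fin d)) : T.logJac R B n x ≤ B := by
  rw [← Real.exp_le_exp, exp_logJac]
  exact max_le (min_le_right _ _) (Real.exp_le_exp.2 h)

theorem jac_le_exp_logJac (T : DoubleSkewProduct P Ξ d) {R B : ℝ} {n : ℕ}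
    {x : Ω × Ξ × EuclideanSpace ℝ (Fin d)} (h : T.jac n x ≤ Real.exp B) :
    T.jac n x ≤ Real.exp (T.logJac R B n x) := by
  rw [exp_logJac, min_eq_left h]; exact le_max_left _ _

theorem continuous_logJac (T : DoubleSkewProduct P Ξ d) (R B : ℝ) (n : ℕ) (ω : Ω) :
    Continuous fun p : Ξ × EuclideanSpace ℝ (Fin d) => T.logJac R B n (ω, p) :=
  Continuous.log (((T.continuous_jac n ω).min continuous_const).max continuous_const)
    fun _ => (lt_max_of_lt_right (Real.exp_pos _)).ne'

section Measurability

variable [CompactSpace Ξ] [BorelSpace Ξ]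

theorem measurable_map (T : DoubleSkewProduct P Ξ d) : Measurable T.map := by
  have hg : Measurable fun x : Ω × Ξ × EuclideanSpace ℝ (Fin d) => T.g x.1 x.2.1 := by
    have h := measurable_uncurry_of_continuous_of_measurable
      (u := fun (ξ : Ξ) (ω : Ω) => T.g ω ξ) (fun ω => (T.g ω).continuous) T.measurable_g
    exact h.comp ((measurable_fst.comp measurable_snd).prodMk measurable_fst)
  have hh : Measurable fun x : Ω × Ξ × EuclideanSpace ℝ (Fin d) => T.h x.1 x.2.1 x.2.2 := by
    have h := measurable_uncurry_of_continuous_of_measurable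
      (u := fun (p : Ξ × EuclideanSpace ℝ (Fin d)) (ω : Ω) => T.h ω p.1 p.2)
      T.continuous_h (fun p => T.measurable_h p.1 p.2)
    exact h.comp (measurable_snd.prodMk measurable_fst)
  exact (T.θ.measurable.comp measurable_fst).prodMk (hg.prodMk hh)

/-- Directional derivatives are limits of measurable difference quotients, and a linear map is
assembled continuously from its finitely many columns. -/
theorem measurable_jac (T : DoubleSkewProduct P Ξ d) (n : ℕ) : Measurable (T.jac n) := by
  have hI : Measurable fun x : Ω × Ξ × EuclideanSpace ℝ (Fin d) => T.hIter n x.1 x.2.1 x.2.2 :=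
    (measurable_snd.comp measurable_snd).comp (T.measurable_map.iterate n)
  have hv : ∀ v, Measurable fun x : Ω × Ξ × EuclideanSpace ℝ (Fin d) =>
      fderiv ℝ (T.hIter n x.1 x.2.1) x.2.2 v := by
    intro v
    refine measurable_of_tendsto_metrizable (f := fun (k : ℕ)
      (x : Ω × Ξ × EuclideanSpace ℝ (Fin d)) => (k : ℝ) •
        (T.hIter n x.1 x.2.1 (x.2.2 + (k : ℝ)⁻¹ • v) - T.hIter n x.1 x.2.1 x.2.2)) (fun k => ?_) ?_
    · refine Measurable.const_smul (Measurable.sub ?_ hI) (k : ℝ)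
      exact hI.comp (f := fun x : Ω × Ξ × EuclideanSpace ℝ (Fin d) =>
        (x.1, x.2.1, x.2.2 + (k : ℝ)⁻¹ • v)) (by fun_prop)
    · refine tendsto_pi_nhds.2 fun x => ?_
      refine (T.differentiable_hIter n x.1 x.2.1 x.2.2).hasFDerivAt.lim v ?_
      simpa using tendsto_natCast_atTop_atTop (R := ℝ)
  have heq : ∀ L : EuclideanSpace ℝ (Fin d) →L[ℝ] EuclideanSpace ℝ (Fin d),
      L = ∑ i, (EuclideanSpace.proj i : EuclideanSpace ℝ (Fin d) →L[ℝ] ℝ).smulRight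
        (L (EuclideanSpace.single i 1)) := by
    intro L
    ext1 v
    conv_lhs => rw [← (EuclideanSpace.basisFun (Fin d) ℝ).sum_repr v]
    simp
  have hjac : T.jac n = fun x => ‖∑ i, (EuclideanSpace.proj i :
      EuclideanSpace ℝ (Fin d) →L[ℝ] ℝ).smulRight
        (fderiv ℝ (T.hIter n x.1 x.2.1) x.2.2 (EuclideanSpace.single i 1))‖ :=
    funext fun x => by rw [← heq]; rfl
  rw [hjac]
  refine (Finset.measurable_fun_sum _ fun i _ => ?_).norm
  have hc : Continuous fun w : EuclideanSpace ℝ (Fin d) => (EuclideanSpace.proj i :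
      EuclideanSpace ℝ (Fin d) →L[ℝ] ℝ).smulRight w :=
    (ContinuousLinearMap.smulRightL ℝ _ _ (EuclideanSpace.proj i :
      EuclideanSpace ℝ (Fin d) →L[ℝ] ℝ)).continuous
  exact hc.measurable.comp (hv _)

theorem measurable_logJac (T : DoubleSkewProduct P Ξ d) (R B : ℝ) (n : ℕ) :
    Measurable (T.logJac R B n) :=
  (((T.measurable_jac n).min measurable_const).max measurable_const).log

end Measurability

end DoubleSkewProduct

theorem measurable_of_continuous_of_measurable_left {Ω M : Type*} [MeasurableSpace Ω]
    [MetricSpace M] [SecondCountableTopology M] [MeasurableSpace M] [BorelSpace M]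
    {u : M → Ω → ℝ≥0∞} (hc : ∀ ω, Continuous fun p => u p ω) (hm : ∀ p, Measurable (u p)) :
    Measurable fun x : Ω × M => u x.2 x.1 := by
  have h : Measurable (Function.uncurry u) := measurable_uncurry_of_continuous_of_measurable hc hm
  exact h.comp (measurable_snd.prodMk measurable_fst)

theorem IsRandomCompact.measurable_infEDist_prod {Ω M : Type*} [MeasurableSpace Ω]
    [MetricSpace M] [SecondCountableTopology M] [MeasurableSpace M] [BorelSpace M]
    {K : Set (Ω × M)} (hK : IsRandomCompact K) :
    Measurable fun x : Ω × M => Metric.infEDist x.2 (fiber K x.1) :=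
  measurable_of_continuous_of_measurable_left (u := fun p ω => Metric.infEDist p (fiber K ω))
    (fun _ => Metric.continuous_infEDist) hK.measurable_infEDist

theorem IsRandomCompact.mem_iff_infEDist {Ω M : Type*} [MeasurableSpace Ω] [MetricSpace M]
    {K : Set (Ω × M)} (hK : IsRandomCompact K) (x : Ω × M) :
    x ∈ K ↔ Metric.infEDist x.2 (fiber K x.1) = 0 :=
  Metric.mem_iff_infEDist_zero_of_closed (hK.isCompact_fiber x.1).isClosed

theorem IsRandomCompact.measurableSet_infEDist_prod_lt {Ω M : Type*} [MeasurableSpace Ω]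
    [MetricSpace M] {K : Set (Ω × M)} (hK : IsRandomCompact K) (p : M × M) (ε : ℝ≥0∞) :
    MeasurableSet {ω | Metric.infEDist p (fiber K ω ×ˢ fiber K ω) < ε} := by
  simp_rw [Metric.infEDist_prod]
  exact measurableSet_lt ((hK.measurable_infEDist _).max (hK.measurable_infEDist _))
    measurable_const

theorem infEDist_le_of_mem {Ω Ξ Y : Type*} [MetricSpace Ξ] [MetricSpace Y]
    {K : Set (Ω × Ξ × Y)} {ω : Ω} {ξ : Ξ}
    {y w : Y} (hy : (ω, ξ, y) ∈ K) :
    Metric.infEDist (ξ, w) (fiber K ω) ≤ ENNReal.ofReal (dist w y) := by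
  have hy' : (ξ, y) ∈ fiber K ω := hy
  refine (Metric.infEDist_le_edist_of_mem hy').trans ?_
  simp [edist_dist]

/-! ### Orbits in tubes around K -/

namespace DoubleSkewProduct

variable {Ω : Type*} [MeasurableSpace Ω] {P : Measure Ω} {Ξ : Type*} [MetricSpace Ξ]
  [MeasurableSpace Ξ] {d : ℕ}

/-- The base points along whose forward orbit `K` is invariant and has connected fibres. -/
def IsRegularPoint (T : DoubleSkewProduct P Ξ d) (K : Set (Ω × Ξ × EuclideanSpace ℝ (Fin d)))
    (ω : Ω) : Prop :=
  ∀ i : ℕ, T.fiberMap (T.θ^[i] ω) '' fiber K (T.θ^[i] ω) = fiber K (T.θ^[i + 1] ω) ∧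
    ∀ ξ : Ξ, IsConnected {y : EuclideanSpace ℝ (Fin d) | (T.θ^[i] ω, ξ, y) ∈ K}

theorem ae_isRegularPoint {T : DoubleSkewProduct P Ξ d}
    {K : Set (Ω × Ξ × EuclideanSpace ℝ (Fin d))} (hinv : T.IsInvariant K)
    (hconn : HasConnectedFibers P K) : ∀ᵐ ω ∂P, T.IsRegularPoint K ω := by
  refine ae_all_iff.2 fun i => ?_
  have h := (T.ergodic_θ.toMeasurePreserving.iterate i).quasiMeasurePreserving.ae (hinv.and hconn)
  filter_upwards [h] with ω hω
  rw [Function.iterate_succ_apply']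
  exact hω

theorem IsRegularPoint.iterate {T : DoubleSkewProduct P Ξ d}
    {K : Set (Ω × Ξ × EuclideanSpace ℝ (Fin d))} {ω : Ω} (h : T.IsRegularPoint K ω) (k : ℕ) :
    T.IsRegularPoint K (T.θ^[k] ω) := by
  intro i
  have := h (i + k)
  rw [show i + k + 1 = (i + 1) + k by ring, Function.iterate_add_apply,
    Function.iterate_add_apply T.θ (i + 1)] at this
  exact this

theorem IsRegularPoint.map_iterate_mem {T : DoubleSkewProduct P Ξ d}
    {K : Set (Ω × Ξ × EuclideanSpace ℝ (Fin d))} {x : Ω × Ξ × EuclideanSpace ℝ (Fin d)}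
    (h : T.IsRegularPoint K x.1) (hx : x ∈ K) (n : ℕ) : T.map^[n] x ∈ K := by
  induction n with
  | zero => exact hx
  | succ n ih =>
    rw [Function.iterate_succ_apply']
    have h1 := (h n).1
    have h2 : (T.map^[n] x).2 ∈ fiber K (T.θ^[n] x.1) := by
      rw [← T.map_iterate_fst]; exact ih
    have h3 : T.fiberMap (T.θ^[n] x.1) (T.map^[n] x).2 ∈ fiber K (T.θ^[n + 1] x.1) :=
      h1 ▸ mem_image_of_mem _ h2
    rw [← T.map_iterate_fst, Function.iterate_succ_apply', ← T.map_iterate_fst] at h3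
    exact h3

theorem IsRegularPoint.exists_map_iterate_eq {T : DoubleSkewProduct P Ξ d}
    {K : Set (Ω × Ξ × EuclideanSpace ℝ (Fin d))} {ω : Ω} (h : T.IsRegularPoint K ω) (n : ℕ) :
    ∀ p ∈ fiber K (T.θ^[n] ω), ∃ q ∈ fiber K ω, (T.map^[n] (ω, q)).2 = p := by
  induction n with
  | zero => exact fun p hp => ⟨p, hp, rfl⟩
  | succ n ih =>
    intro p hp
    rw [← (h n).1] at hp
    obtain ⟨p', hp', rfl⟩ := hp
    obtain ⟨q, hq, rfl⟩ := ih p' hp'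
    refine ⟨q, hq, ?_⟩
    rw [Function.iterate_succ_apply']
    change T.fiberMap (T.map^[n] (ω, q)).1 _ = _
    rw [T.map_iterate_fst]

/-- The points whose orbit stays `δ`-close to `K` up to time `n`. -/
def tube (T : DoubleSkewProduct P Ξ d) (K : Set (Ω × Ξ × EuclideanSpace ℝ (Fin d))) (n : ℕ)
    (δ : ℝ) : Set (Ω × Ξ × EuclideanSpace ℝ (Fin d)) :=
  {x | ∀ i ≤ n, Metric.infEDist (T.map^[i] x).2 (fiber K (T.map^[i] x).1) < ENNReal.ofReal δ}

theorem IsRegularPoint.mem_tube {T : DoubleSkewProduct P Ξ d}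
    {K : Set (Ω × Ξ × EuclideanSpace ℝ (Fin d))} {x : Ω × Ξ × EuclideanSpace ℝ (Fin d)}
    (h : T.IsRegularPoint K x.1) (hx : x ∈ K) (n : ℕ) {δ : ℝ} (hδ : 0 < δ) : x ∈ T.tube K n δ := by
  intro i _
  have h1 : (T.map^[i] x).2 ∈ fiber K (T.map^[i] x).1 := h.map_iterate_mem hx i
  rw [Metric.infEDist_zero_of_mem h1]
  exact ENNReal.ofReal_pos.2 hδ

theorem isOpen_tube_fiber (T : DoubleSkewProduct P Ξ d)
    (K : Set (Ω × Ξ × EuclideanSpace ℝ (Fin d))) (n : ℕ) (δ : ℝ) (ω : Ω) :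
    IsOpen {p | (ω, p) ∈ T.tube K n δ} := by
  have : {p | (ω, p) ∈ T.tube K n δ} = ⋂ i ∈ Finset.range (n + 1),
      {p | Metric.infEDist (T.map^[i] (ω, p)).2 (fiber K (T.θ^[i] ω)) < ENNReal.ofReal δ} := by
    ext p
    simp only [tube, mem_ofPred_eq, Finset.mem_range, mem_iInter, Nat.lt_succ_iff, map_iterate_fst]
  rw [this]
  refine isOpen_biInter_finset fun i _ => ?_
  exact isOpen_lt (Metric.continuous_infEDist.comp (T.continuous_map_iterate_snd i ω))
    continuous_const

/-- Expansion in the fibre direction is bounded by `exp C` in the `r`-neighbourhood of `K`. -/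
def ExpansionBound (T : DoubleSkewProduct P Ξ d) (K : Set (Ω × Ξ × EuclideanSpace ℝ (Fin d)))
    (C r : ℝ) : Prop :=
  ∀ x : Ω × Ξ × EuclideanSpace ℝ (Fin d),
    Metric.infEDist x.2 (fiber K x.1) < ENNReal.ofReal r → T.jac 1 x ≤ Real.exp C

theorem UniformDerivative.exists_expansionBound {T : DoubleSkewProduct P Ξ d}
    {K : Set (Ω × Ξ × EuclideanSpace ℝ (Fin d))}
    (hfin : (⨆ (ω : Ω) (p ∈ fiber K ω), T.Phi 1 (ω, p)) < ⊤) (hunif : T.UniformDerivative K) :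
    ∃ C r : ℝ, 0 ≤ C ∧ 0 < r ∧ T.ExpansionBound K C r := by
  obtain ⟨r, hr, hle⟩ := hunif 1 1 one_pos
  obtain ⟨C₀, hC₀⟩ := EReal.lt_iff_exists_real_btwn.1 hfin
  -- The term 1 is the tolerance ε of the derivative condition; the maximum with 0 ensures exp C ≥
  -- 1.
  refine ⟨max (C₀ + 1) 0, r, le_max_right _ _, hr, fun x hx => ?_⟩
  rw [← Phi_le_iff]
  have h1 : T.Phi 1 x ≤ ⨆ (ω : Ω) (p ∈ Metric.thickening r (fiber K ω)), T.Phi 1 (ω, p) :=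
    le_iSup_of_le x.1 (le_iSup₂_of_le x.2
      (Metric.mem_thickening_iff_infEDist_lt.2 hx) le_rfl)
  refine (h1.trans hle).trans ?_
  calc _ ≤ (C₀ : EReal) + ((1 : ℝ) : EReal) := add_le_add hC₀.1.le le_rfl
    _ = ((C₀ + 1 : ℝ) : EReal) := by rw [EReal.coe_add]
    _ ≤ _ := EReal.coe_le_coe_iff.2 (le_max_left _ _)

/-- The chain rule from time i evaluates one-step derivatives at times i, …, i + l - 1 only, hence i
+ l may reach n + 1. -/
theorem ExpansionBound.jac_le {T : DoubleSkewProduct P Ξ d}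
    {K : Set (Ω × Ξ × EuclideanSpace ℝ (Fin d))} {C r : ℝ} (hb : T.ExpansionBound K C r)
    {n : ℕ} {δ : ℝ} (hδ : δ ≤ r) {x : Ω × Ξ × EuclideanSpace ℝ (Fin d)} (hx : x ∈ T.tube K n δ) :
    ∀ i l, i + l ≤ n + 1 → T.jac l (T.map^[i] x) ≤ Real.exp (l * C) := by
  intro i l
  induction l with
  | zero => intro _; simpa using T.jac_zero_le _
  | succ l ih =>
    intro hl
    have h1 : T.jac 1 (T.map^[l] (T.map^[i] x)) ≤ Real.exp C := by
      rw [← Function.iterate_add_apply]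
      exact hb _ ((hx (l + i) (by omega)).trans_le (ENNReal.ofReal_le_ofReal hδ))
    calc T.jac (l + 1) (T.map^[i] x)
        ≤ T.jac 1 (T.map^[l] (T.map^[i] x)) * T.jac l (T.map^[i] x) := T.jac_add_le l 1 _
      _ ≤ Real.exp C * Real.exp (l * C) :=
          mul_le_mul h1 (ih (by omega)) (T.jac_nonneg _ _) (Real.exp_pos _).le
      _ = Real.exp ((l + 1 : ℕ) * C) := by rw [← Real.exp_add]; push_cast; ring_nf

theorem dist_le_mul_of_jac_le (T : DoubleSkewProduct P Ξ d) (n : ℕ) (ω : Ω) (ξ : Ξ)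
    {y : EuclideanSpace ℝ (Fin d)} {ρ L : ℝ}
    (h : ∀ w ∈ Metric.ball y ρ, T.jac n (ω, ξ, w) ≤ L) {w : EuclideanSpace ℝ (Fin d)}
    (hw : dist w y < ρ) :
    dist (T.hIter n ω ξ w) (T.hIter n ω ξ y) ≤ L * dist w y := by
  rw [dist_eq_norm, dist_eq_norm]
  exact (convex_ball y ρ).norm_image_sub_le_of_norm_fderiv_le
    (fun z _ => T.differentiable_hIter n ω ξ z) h
    (Metric.mem_ball_self (dist_nonneg.trans_lt hw)) hw

theorem ExpansionBound.dist_hIter_one_le {T : DoubleSkewProduct P Ξ d}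
    {K : Set (Ω × Ξ × EuclideanSpace ℝ (Fin d))} {C r : ℝ} (hb : T.ExpansionBound K C r)
    {ω : Ω} {ξ : Ξ} {y w : EuclideanSpace ℝ (Fin d)} (hy : (ω, ξ, y) ∈ K) (hw : dist w y < r) :
    dist (T.hIter 1 ω ξ w) (T.hIter 1 ω ξ y) ≤ Real.exp C * dist w y := by
  refine T.dist_le_mul_of_jac_le 1 ω ξ (fun z hz => hb _ ?_) hw
  refine (infEDist_le_of_mem hy).trans_lt ?_
  exact (ENNReal.ofReal_lt_ofReal_iff (dist_nonneg.trans_lt hw)).2 hz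

/-- The initial radius δ exp(-mC) absorbs m steps of worst-case expansion, so the orbit of w stays
δ-close to the orbit of y, which lies in K. The point w itself need not belong to K. -/
theorem ExpansionBound.dist_hIter_le {T : DoubleSkewProduct P Ξ d}
    {K : Set (Ω × Ξ × EuclideanSpace ℝ (Fin d))} {C r : ℝ} (hC : 0 ≤ C)
    (hb : T.ExpansionBound K C r) {m : ℕ} {δ : ℝ} (hδ : δ ≤ r) {ω : Ω}
    (hω : T.IsRegularPoint K ω) {ξ : Ξ} {y w : EuclideanSpace ℝ (Fin d)} (hy : (ω, ξ, y) ∈ K)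
    (hw : dist w y < δ * Real.exp (-(m * C))) :
    ∀ i ≤ m, dist (T.hIter i ω ξ w) (T.hIter i ω ξ y) ≤ Real.exp (i * C) * dist w y ∧
      dist (T.hIter i ω ξ w) (T.hIter i ω ξ y) < δ := by
  have hlt : ∀ i ≤ m, Real.exp (i * C) * dist w y < δ := by
    intro i hi
    calc Real.exp (i * C) * dist w y ≤ Real.exp (m * C) * dist w y := by gcongr
      _ < Real.exp (m * C) * (δ * Real.exp (-(m * C))) := by gcongr
      _ = δ := by rw [mul_left_comm, ← Real.exp_add]; simp
  have main : ∀ i ≤ m, dist (T.hIter i ω ξ w) (T.hIter i ω ξ y) ≤ Real.exp (i * C) * dist w y := by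
    intro i
    induction i with
    | zero => intro _; simp [hIter]
    | succ i ih =>
      intro hi
      have h1 := ih (by omega)
      have h2 := h1.trans_lt (hlt i (by omega))
      have hmem : (T.θ^[i] ω, T.gIter i ω ξ, T.hIter i ω ξ y) ∈ K := by
        rw [← map_iterate]; exact hω.map_iterate_mem (x := (ω, ξ, y)) hy i
      rw [hIter_add, hIter_add]
      calc _ ≤ Real.exp C * dist (T.hIter i ω ξ w) (T.hIter i ω ξ y) :=
            hb.dist_hIter_one_le hmem (h2.trans_le hδ)
        _ ≤ Real.exp C * (Real.exp (i * C) * dist w y) := by gcongr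
        _ = _ := by rw [← mul_assoc, ← Real.exp_add]; push_cast; ring_nf
  exact fun i hi => ⟨main i hi, (main i hi).trans_lt (hlt i hi)⟩

/-- The whole ball around y lies in the tube, so the mean value inequality applies to the m-th
iterate with the bound that c provides. -/
theorem ExpansionBound.dist_hIter_le_exp_mul {T : DoubleSkewProduct P Ξ d}
    {K : Set (Ω × Ξ × EuclideanSpace ℝ (Fin d))} {C r : ℝ} (hC : 0 ≤ C)
    (hb : T.ExpansionBound K C r) {m : ℕ} {δ R : ℝ} (hδ : δ ≤ r) {c : Ω → ℝ}
    (hc : ∀ x ∈ T.tube K m δ, T.logJac R (m * C) m x ≤ c x.1) {ω : Ω}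
    (hω : T.IsRegularPoint K ω) {ξ : Ξ} {y w : EuclideanSpace ℝ (Fin d)} (hy : (ω, ξ, y) ∈ K)
    (hw : dist w y < δ * Real.exp (-(m * C))) :
    dist (T.hIter m ω ξ w) (T.hIter m ω ξ y) ≤ Real.exp (c ω) * dist w y := by
  refine T.dist_le_mul_of_jac_le m ω ξ (fun z hz => ?_) hw
  have htube : (ω, ξ, z) ∈ T.tube K m δ := by
    intro i hi
    have h1 := (hb.dist_hIter_le hC hδ hω hy hz i hi).2
    have hmem : (T.θ^[i] ω, T.gIter i ω ξ, T.hIter i ω ξ y) ∈ K := by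
      rw [← map_iterate]; exact hω.map_iterate_mem (x := (ω, ξ, y)) hy i
    rw [map_iterate]
    refine (infEDist_le_of_mem hmem).trans_lt ?_
    exact (ENNReal.ofReal_lt_ofReal_iff (dist_nonneg.trans_lt h1)).2 h1
  have hle : T.jac m (ω, ξ, z) ≤ Real.exp (m * C) := hb.jac_le hδ htube 0 m (by omega)
  refine (T.jac_le_exp_logJac (R := R) hle).trans ?_
  exact Real.exp_le_exp.2 (hc _ htube)

/-! ### Contraction along orbits and collapse of the fibres -/

/-- Nearby points of `K` over the same point of `Ξ` are contracted along orbits with negative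
drift. -/
theorem ExpansionBound.exists_contraction {T : DoubleSkewProduct P Ξ d}
    {K : Set (Ω × Ξ × EuclideanSpace ℝ (Fin d))} {C r : ℝ} (hC : 0 ≤ C)
    (hb : T.ExpansionBound K C r) {m : ℕ} (hm : 1 ≤ m) {δ R : ℝ} (hδ0 : 0 < δ) (hδ : δ ≤ r)
    {c : Ω → ℝ} (hc : ∀ x ∈ T.tube K m δ, T.logJac R (m * C) m x ≤ c x.1) {ω : Ω}
    (hω : T.IsRegularPoint K ω) {B ε : ℝ} (hB : 0 ≤ B) (hε : 0 < ε)
    (hsum : ∀ k : ℕ, ∑ i ∈ Finset.range k, c (T.θ^[i] ω) ≤ B - k * ε) :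
    ∃ ρ : ℝ, 0 < ρ ∧ ∀ η : ℝ, 0 < η → ∃ L₀ : ℕ, ∀ L ≥ L₀, ∀ ξ y y', (ω, ξ, y) ∈ K →
      (ω, ξ, y') ∈ K → dist y y' < ρ → dist (T.hIter L ω ξ y) (T.hIter L ω ξ y') ≤ η := by
  have hE : 1 ≤ Real.exp C := Real.one_le_exp hC
  set X := Real.exp C ^ (2 * m * m) * Real.exp B with hX
  have hX1 : 1 ≤ X := one_le_mul_of_one_le_of_one_le (one_le_pow₀ hE) (Real.one_le_exp hB)
  have hXpos : 0 < X := by positivity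
  set ρ₀ := δ * Real.exp (-(m * C)) with hρ₀
  have hρ₀pos : 0 < ρ₀ := by positivity
  have hρ₀r : ρ₀ ≤ r := by
    refine le_trans ?_ hδ
    calc ρ₀ ≤ δ * 1 := by
          rw [hρ₀]; gcongr; exact Real.exp_le_one_iff.2 (neg_nonpos.2 (by positivity))
      _ = δ := mul_one δ
  -- X collects the losses of the block estimate and of the drift bound. Since X ≥ 1, X * ρ ^ m ≤ ρ₀
  -- ^ m, so pairs starting closer than ρ never separate beyond ρ₀.
  set ρ := ρ₀ / X with hρ
  have hρpos : 0 < ρ := by positivity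
  have hρle : ρ ≤ ρ₀ := div_le_self hρ₀pos.le hX1
  have horbit : ∀ {ξ y}, (ω, ξ, y) ∈ K → ∀ i, (T.θ^[i] ω, T.gIter i ω ξ, T.hIter i ω ξ y) ∈ K := by
    intro ξ y hy i
    rw [← map_iterate]; exact hω.map_iterate_mem (x := (ω, ξ, y)) hy i
  have hprod : ∀ k : ℕ, ∏ i ∈ Finset.range k, Real.exp (c (T.θ^[i] ω)) ≤
      Real.exp B * Real.exp (-(k * ε)) := by
    intro k
    rw [← Real.exp_sum, ← Real.exp_add]
    exact Real.exp_le_exp.2 ((hsum k).trans_eq (by ring))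
  have main : ∀ ξ y y', (ω, ξ, y) ∈ K → (ω, ξ, y') ∈ K → dist y y' < ρ → ∀ k : ℕ,
      dist (T.hIter (k + m) ω ξ y) (T.hIter (k + m) ω ξ y') ^ m ≤
        X * ρ ^ m * Real.exp (-(k * ε)) := by
    intro ξ y y' hy hy' hd
    set a : ℕ → ℝ := fun i => dist (T.hIter i ω ξ y) (T.hIter i ω ξ y') with ha
    have ha0 : a 0 < ρ := hd
    have ha_nonneg : ∀ i, 0 ≤ a i := fun i => dist_nonneg
    have step : ∀ i, a i < ρ₀ → a (i + 1) ≤ Real.exp C * a i := by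
      intro i hi
      simp only [ha, hIter_add T i 1]
      exact hb.dist_hIter_one_le (horbit hy' i) (lt_of_lt_of_le hi hρ₀r)
    have block : ∀ i, a i < ρ₀ → a (i + m) ≤ Real.exp (c (T.θ^[i] ω)) * a i := by
      intro i hi
      simp only [ha, hIter_add T i m]
      exact hb.dist_hIter_le_exp_mul hC hδ hc (hω.iterate i) (horbit hy' i) hi
    have bound : ∀ k, (∀ i < k + m, a i < ρ₀) → a (k + m) ^ m ≤
        X * a 0 ^ m * Real.exp (-(k * ε)) := by
      intro k hk
      refine (pow_le_mul_prod_of_block (q := fun i => Real.exp (c (T.θ^[i] ω))) hE ha_nonneg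
        (fun i => (Real.exp_pos _).le) hm (fun i hi => step i (hk i hi))
        (fun i hi => block i (hk i (by omega)))).trans ?_
      calc _ ≤ Real.exp C ^ (2 * m * m) * a 0 ^ m * (Real.exp B * Real.exp (-(k * ε))) := by
            exact mul_le_mul_of_nonneg_left (hprod k)
              (mul_nonneg (by positivity) (pow_nonneg (ha_nonneg 0) _))
        _ = _ := by rw [hX]; ring
    -- The block estimate at time i only needs closeness at earlier times, hence strong induction.
    -- It starts at time m; before that the crude expansion bound suffices.
    have small : ∀ i, a i < ρ₀ := by
      intro i
      induction i using Nat.strong_induction_on with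
      | _ i ih =>
        rcases lt_or_ge i m with him | him
        · have h1 := (hb.dist_hIter_le hC hδ hω hy' (ha0.trans_le hρle) i him.le).1
          refine h1.trans_lt ?_
          calc Real.exp (i * C) * dist y y' ≤ X * dist y y' := by
                gcongr
                calc Real.exp (i * C) = Real.exp C ^ i := Real.exp_nat_mul C i
                  _ ≤ Real.exp C ^ (2 * m * m) := pow_le_pow_right₀ hE (by nlinarith)
                  _ ≤ X := le_mul_of_one_le_right (by positivity) (Real.one_le_exp hB)
            _ < X * ρ := by gcongr
            _ = ρ₀ := by rw [hρ]; field_simp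
        · obtain ⟨k, rfl⟩ := Nat.exists_eq_add_of_le' him
          have h1 := bound k ih
          refine lt_of_pow_lt_pow_left₀ m hρ₀pos.le (h1.trans_lt ?_)
          calc X * a 0 ^ m * Real.exp (-(k * ε)) ≤ X * a 0 ^ m * 1 := by
                refine mul_le_mul_of_nonneg_left ?_
                  (mul_nonneg hXpos.le (pow_nonneg (ha_nonneg 0) _))
                exact Real.exp_le_one_iff.2 (neg_nonpos.2 (by positivity))
            _ < X ^ m * ρ ^ m := by
                rw [mul_one]
                refine mul_lt_mul' (le_self_pow₀ hX1 (by omega))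
                  (pow_lt_pow_left₀ ha0 (ha_nonneg 0) (by omega))
                  (pow_nonneg (ha_nonneg 0) _) (by positivity)
            _ = ρ₀ ^ m := by rw [← mul_pow, hρ]; congr 1; field_simp
    intro k
    refine (bound k fun i _ => small i).trans ?_
    gcongr
  refine ⟨ρ, hρpos, fun η hη => ?_⟩
  have hlim : Tendsto (fun k : ℕ => X * ρ ^ m * Real.exp (-(k * ε))) atTop (𝓝 0) := by
    have h1 : Tendsto (fun k : ℕ => (k : ℝ) * ε) atTop atTop :=
      tendsto_natCast_atTop_atTop.atTop_mul_const hε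
    simpa using (Real.tendsto_exp_neg_atTop_nhds_zero.comp h1).const_mul (X * ρ ^ m)
  obtain ⟨k₀, hk₀⟩ := eventually_atTop.1 (hlim.eventually_lt_const (show 0 < η ^ m by positivity))
  refine ⟨k₀ + m, fun L hL ξ y y' hy hy' hd => ?_⟩
  obtain ⟨k, rfl⟩ := Nat.exists_eq_add_of_le' (show m ≤ L by omega)
  exact (lt_of_pow_lt_pow_left₀ m hη.le
    ((main ξ y y' hy hy' hd k).trans_lt (hk₀ k (by omega)))).le

/-- Along orbits with negative drift the diameters of the connected fibres tend to zero. -/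
theorem ExpansionBound.eventually_dist_le {T : DoubleSkewProduct P Ξ d}
    {K : Set (Ω × Ξ × EuclideanSpace ℝ (Fin d))} (hK : IsRandomCompact K) {ω : Ω}
    (hω : T.IsRegularPoint K ω) {ρ : ℝ} (hρ : 0 < ρ)
    (hcontr : ∀ η : ℝ, 0 < η → ∃ L₀ : ℕ, ∀ L ≥ L₀, ∀ ξ y y', (ω, ξ, y) ∈ K →
      (ω, ξ, y') ∈ K → dist y y' < ρ → dist (T.hIter L ω ξ y) (T.hIter L ω ξ y') ≤ η)
    {η : ℝ} (hη : 0 < η) :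
    ∃ L₀ : ℕ, ∀ L ≥ L₀, ∀ ξ y y', (ω, ξ, y) ∈ K → (ω, ξ, y') ∈ K →
      dist (T.hIter L ω ξ y) (T.hIter L ω ξ y') ≤ η := by
  -- One finite cover of the projected fibre serves all ξ, so the number of balls and the time L₀ do
  -- not depend on ξ.
  have hcomp : IsCompact (Prod.snd '' fiber K ω) :=
    (hK.isCompact_fiber ω).image continuous_snd
  obtain ⟨t, _, ht⟩ := hcomp.elim_nhds_subcover (fun y => Metric.ball y (ρ / 2))
    fun y _ => Metric.ball_mem_nhds y (half_pos hρ)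
  obtain ⟨L₀, hL₀⟩ := hcontr (η / (2 * t.card + 1)) (by positivity)
  refine ⟨L₀, fun L hL ξ y y' hy hy' => ?_⟩
  have hS : IsPreconnected {y : EuclideanSpace ℝ (Fin d) | (ω, ξ, y) ∈ K} :=
    ((hω 0).2 ξ).isPreconnected
  have := dist_le_of_isPreconnected_of_cover hS (t := t) (ρ := ρ)
    (fun z hz => ht ⟨(ξ, z), hz, rfl⟩) (f := T.hIter L ω ξ)
    (T.differentiable_hIter L ω ξ).continuous.continuousOn (η := η / (2 * t.card + 1))
    (by positivity) (fun x hx z hz hd => hL₀ L hL ξ x z hx hz hd) hy hy'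
  refine this.trans ?_
  rw [mul_comm 2, mul_assoc, div_mul_eq_mul_div, div_le_iff₀ (by positivity)]
  nlinarith

/-- If the truncated logarithmic expansion has a negative mean in a tube around `K`, then the
fibres of `K` over `Ω × Ξ` have at most one point. -/
theorem ExpansionBound.ae_subsingleton [CompactSpace Ξ] [BorelSpace Ξ] [IsProbabilityMeasure P]
    {T : DoubleSkewProduct P Ξ d}
    {K : Set (Ω × Ξ × EuclideanSpace ℝ (Fin d))} (hK : IsRandomCompact K)
    (hinv : T.IsInvariant K) (hconn : HasConnectedFibers P K) {C r : ℝ} (hC : 0 ≤ C)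
    (hb : T.ExpansionBound K C r) {m : ℕ} (hm : 1 ≤ m) {δ R : ℝ} (hδ0 : 0 < δ) (hδ : δ ≤ r)
    {c : Ω → ℝ} (hc : ∀ x ∈ T.tube K m δ, T.logJac R (m * C) m x ≤ c x.1)
    (hcm : Measurable c) (hci : Integrable c P) (hneg : ∫ ω, c ω ∂P < 0) :
    ∀ᵐ ω ∂P, ∀ ξ y y', (ω, ξ, y) ∈ K → (ω, ξ, y') ∈ K → y = y' := by
  obtain ⟨ε, hε, hsum⟩ := ae_exists_sum_le_of_integral_neg T.ergodic_θ hci hcm hneg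
  set W : ℝ → Set Ω := fun η => {ω | ((fiber K ω ×ˢ fiber K ω) ∩
    {p : (Ξ × EuclideanSpace ℝ (Fin d)) × (Ξ × EuclideanSpace ℝ (Fin d)) |
      p.1.1 = p.2.1 ∧ η ≤ dist p.1.2 p.2.2}).Nonempty} with hW
  have hWm : ∀ η, MeasurableSet (W η) := by
    intro η
    refine measurableSet_inter_nonempty
      (fun ω => (hK.isCompact_fiber ω).prod (hK.isCompact_fiber ω))
      hK.measurableSet_infEDist_prod_lt ?_
    exact (isClosed_eq (continuous_fst.comp continuous_fst)
      (continuous_fst.comp continuous_snd)).inter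
      (isClosed_le continuous_const ((continuous_snd.comp continuous_fst).dist
        (continuous_snd.comp continuous_snd)))
  have hnull : ∀ η, 0 < η → P (W η) = 0 := by
    intro η hη
    -- A pair over θ^L ω at distance at least η pulls back to K(ω), by surjectivity on fibres, and
    -- to a common ξ, by injectivity of the base iterates. For large L this contradicts the
    -- shrinking of the fibres.
    have hlim : Tendsto (fun L : ℕ => P (T.θ^[L] ⁻¹' W η)) atTop (𝓝 (P ∅)) := by
      refine tendsto_measure_of_ae_tendsto_indicator_of_isFiniteMeasure atTop
        MeasurableSet.empty (fun L => (hWm η).preimage (T.θ.measurable.iterate L)) ?_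
      filter_upwards [hsum, ae_isRegularPoint hinv hconn] with ω ⟨B, hB, hωs⟩ hω
      obtain ⟨ρ, hρ, hcontr⟩ := hb.exists_contraction hC hm hδ0 hδ hc hω hB hε hωs
      obtain ⟨L₀, hL₀⟩ := ExpansionBound.eventually_dist_le hK hω hρ hcontr (half_pos hη)
      filter_upwards [eventually_ge_atTop L₀] with L hL
      simp only [mem_empty_iff_false, iff_false]
      rintro ⟨⟨p, p'⟩, ⟨hp, hp'⟩, heq, hle⟩
      obtain ⟨⟨ξ, y⟩, hq, hqp⟩ := hω.exists_map_iterate_eq L p hp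
      obtain ⟨⟨ξ', y'⟩, hq', hqp'⟩ := hω.exists_map_iterate_eq L p' hp'
      rw [map_iterate] at hqp hqp'
      subst hqp
      subst hqp'
      obtain rfl : ξ = ξ' := T.gIter_injective L ω heq
      have := hL₀ L hL ξ y y' hq hq'
      simp only at hle
      linarith
    simp_rw [fun L => (T.ergodic_θ.toMeasurePreserving.iterate L).measure_preimage
      (hWm η).nullMeasurableSet] at hlim
    simpa using tendsto_nhds_unique tendsto_const_nhds hlim
  have hall : ∀ᵐ ω ∂P, ∀ n : ℕ, ω ∉ W (1 / ((n : ℝ) + 1)) :=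
    ae_all_iff.2 fun n => measure_eq_zero_iff_ae_notMem.1 (hnull _ (by positivity))
  filter_upwards [hall] with ω hω ξ y y' hy hy'
  by_contra hne
  obtain ⟨n, hn⟩ := exists_nat_one_div_lt (dist_pos.2 hne)
  exact hω n ⟨((ξ, y), (ξ, y')), ⟨hy, hy'⟩, rfl, hn.le⟩

end DoubleSkewProduct

/-! ### From singleton fibres to a random continuous graph -/

/-- A random compact set whose fibres over `Ω × Ξ` are singletons is a random continuous graph. -/
theorem exists_isRandomContinuous_of_subsingleton {Ω : Type*} [MeasurableSpace Ω] {P : Measure Ω}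
    {Ξ : Type*} [MetricSpace Ξ] [CompactSpace Ξ] {d : ℕ}
    {K : Set (Ω × Ξ × EuclideanSpace ℝ (Fin d))} (hK : IsRandomCompact K)
    (hne : ∀ᵐ ω ∂P, ∀ ξ : Ξ, {y : EuclideanSpace ℝ (Fin d) | (ω, ξ, y) ∈ K}.Nonempty)
    (hsub : ∀ᵐ ω ∂P, ∀ ξ y y', (ω, ξ, y) ∈ K → (ω, ξ, y') ∈ K → y = y') :
    ∃ φ : Ω × Ξ → EuclideanSpace ℝ (Fin d), IsRandomContinuous φ ∧
      ∀ᵐ ω ∂P, fiber K ω = {p | ∃ ξ : Ξ, p = (ξ, φ (ω, ξ))} := by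
  classical
  obtain ⟨t, hst, htm, ht⟩ := exists_measurable_superset_of_null (ae_iff.1 (hne.and hsub))
  have hG : ∀ ω, ω ∉ t → (∀ ξ : Ξ, ∃ y : EuclideanSpace ℝ (Fin d), (ω, ξ, y) ∈ K) ∧
      ∀ ξ y y', (ω, ξ, y) ∈ K → (ω, ξ, y') ∈ K → y = y' :=
    fun ω hω => by_contra fun h => hω (hst h)
  -- The value 0 over the measurable null set t makes continuity and measurability hold without
  -- exceptional points.
  have hex : ∀ x : Ω × Ξ, ∃ y : EuclideanSpace ℝ (Fin d),
      (x.1 ∉ t → (x.1, x.2, y) ∈ K) ∧ (x.1 ∈ t → y = 0) := by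
    intro x
    by_cases h : x.1 ∈ t
    · exact ⟨0, fun h' => absurd h h', fun _ => rfl⟩
    · obtain ⟨y, hy⟩ := (hG x.1 h).1 x.2
      exact ⟨y, fun _ => hy, fun h' => absurd h' h⟩
  choose φ hφ hφ0 using hex
  have hmem : ∀ ω ∉ t, ∀ ξ y, (ω, ξ, y) ∈ K ↔ y = φ (ω, ξ) := fun ω hω ξ y =>
    ⟨fun h => (hG ω hω).2 ξ _ _ h (hφ (ω, ξ) hω), fun h => h ▸ hφ (ω, ξ) hω⟩
  refine ⟨φ, ⟨fun ω => ?_, fun ξ => ?_⟩, ?_⟩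
  · by_cases hω : ω ∈ t
    · simp_rw [fun ξ => hφ0 (ω, ξ) hω]
      exact continuous_const
    · refine continuous_iff_isClosed.2 fun C hC => ?_
      -- Closed graph argument: the preimage is the projection of a compact set.
      have : (fun ξ => φ (ω, ξ)) ⁻¹' C = Prod.fst '' (fiber K ω ∩ Prod.snd ⁻¹' C) := by
        ext ξ
        constructor
        · intro h
          exact ⟨(ξ, φ (ω, ξ)), ⟨hφ (ω, ξ) hω, h⟩, rfl⟩
        · rintro ⟨⟨ξ', y⟩, ⟨h1, h2⟩, rfl⟩
          have h3 : y = φ (ω, ξ') := (hmem ω hω ξ' y).1 h1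
          have h4 : y ∈ C := h2
          rwa [h3] at h4
      rw [this]
      exact (((hK.isCompact_fiber ω).inter_right (hC.preimage continuous_snd)).image
        continuous_fst).isClosed
  · refine measurable_of_isClosed fun C hC => ?_
    have : (fun ω => φ (ω, ξ)) ⁻¹' C =
        ({ω | (fiber K ω ∩ ({ξ} ×ˢ C)).Nonempty} \ t) ∪
          (t ∩ {_ω | (0 : EuclideanSpace ℝ (Fin d)) ∈ C}) := by
      ext ω
      by_cases hω : ω ∈ t
      · simp [hω, hφ0 (ω, ξ) hω]
      · simp only [mem_preimage, mem_union, Set.mem_sdiff, hω, not_false_eq_true, and_true, mem_inter_iff,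
          false_and, or_false, mem_ofPred_eq]
        constructor
        · intro h
          exact ⟨(ξ, φ (ω, ξ)), hφ (ω, ξ) hω, rfl, h⟩
        · rintro ⟨⟨ξ', y⟩, h1, h2, h3⟩
          obtain rfl : ξ' = ξ := h2
          have h4 : y = φ (ω, ξ') := (hmem ω hω ξ' y).1 h1
          have h5 : y ∈ C := h3
          rwa [h4] at h5
    rw [this]
    refine ((measurableSet_inter_nonempty hK.isCompact_fiber
      (fun x ε => measurableSet_lt (hK.measurable_infEDist x) measurable_const)
      (isClosed_singleton.prod hC)).diff htm).union (htm.inter (MeasurableSet.const _))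
  · have : ∀ᵐ ω ∂P, ω ∉ t := measure_eq_zero_iff_ae_notMem.1 ht
    filter_upwards [this] with ω hω
    ext ⟨ξ, y⟩
    constructor
    · intro h
      exact ⟨ξ, by rw [(hmem ω hω ξ y).1 h]⟩
    · rintro ⟨ξ', h⟩
      obtain ⟨rfl, rfl⟩ := Prod.mk.inj h
      exact hφ (ω, ξ) hω

/-! ### Markov kernels: midpoints, limits, empirical averages -/

/-- The integral of a function on the product with respect to the disintegrated measure. -/
noncomputable def kernelIntegral {Ω M : Type*} [MeasurableSpace Ω] [MeasurableSpace M]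
    (P : Measure Ω) (κ : Kernel Ω M) (F : Ω × M → ℝ) : ℝ :=
  ∫ ω, ∫ p, F (ω, p) ∂(κ ω) ∂P

section Kernels

variable {Ω M : Type*} [MeasurableSpace Ω] [MeasurableSpace M] {P : Measure Ω}

theorem integrable_of_abs_le {X : Type*} [MeasurableSpace X] {μ : Measure X} [IsFiniteMeasure μ]
    {F : X → ℝ} (hF : Measurable F) {B : ℝ} (hB : ∀ x, |F x| ≤ B) : Integrable F μ :=
  Integrable.of_bound hF.aestronglyMeasurable B (ae_of_all _ hB)

theorem measurable_integral_kernel (κ : Kernel Ω M) [IsMarkovKernel κ] {F : Ω × M → ℝ}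
    (hF : Measurable F) : Measurable fun ω => ∫ p, F (ω, p) ∂(κ ω) :=
  hF.stronglyMeasurable.integral_kernel_prod_right'.measurable

theorem abs_integral_kernel_le (κ : Kernel Ω M) [IsMarkovKernel κ] {F : Ω × M → ℝ}
    {B : ℝ} (hB : ∀ x, |F x| ≤ B) (ω : Ω) : |∫ p, F (ω, p) ∂(κ ω)| ≤ B := by
  have := norm_integral_le_of_norm_le_const (μ := κ ω) (f := fun p => F (ω, p)) (C := B)
    (ae_of_all _ fun p => hB (ω, p))
  simpa using this

theorem integral_compProd_eq_kernelIntegral [IsProbabilityMeasure P] (κ : Kernel Ω M)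
    [IsMarkovKernel κ] {F : Ω × M → ℝ} (hF : Measurable F) {B : ℝ} (hB : ∀ x, |F x| ≤ B) :
    ∫ x, F x ∂(P ⊗ₘ κ) = kernelIntegral P κ F :=
  Measure.integral_compProd (integrable_of_abs_le hF hB)

/-- The average of two kernels. -/
noncomputable def midKernel (κ κ' : Kernel Ω M) : Kernel Ω M where
  toFun ω := (2⁻¹ : ℝ≥0∞) • (κ ω + κ' ω)
  measurable' := by
    refine Measure.measurable_of_measurable_coe _ fun s hs => ?_
    simp only [Measure.smul_apply, Measure.add_apply]
    exact ((κ.measurable_coe hs).add (κ'.measurable_coe hs)).const_smul (2⁻¹ : ℝ≥0∞)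

theorem midKernel_apply (κ κ' : Kernel Ω M) (ω : Ω) :
    midKernel κ κ' ω = (2⁻¹ : ℝ≥0∞) • (κ ω + κ' ω) := rfl

theorem isMarkovKernel_midKernel (κ κ' : Kernel Ω M) [IsMarkovKernel κ] [IsMarkovKernel κ'] :
    IsMarkovKernel (midKernel κ κ') := by
  refine ⟨fun ω => ⟨?_⟩⟩
  simp only [midKernel_apply, Measure.smul_apply, Measure.add_apply, measure_univ, smul_eq_mul]
  rw [one_add_one_eq_two]
  exact ENNReal.inv_mul_cancel (by simp) (by simp)

theorem kernelIntegral_midKernel [IsProbabilityMeasure P] (κ κ' : Kernel Ω M) [IsMarkovKernel κ]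
    [IsMarkovKernel κ'] {F : Ω × M → ℝ} (hF : Measurable F) {B : ℝ} (hB : ∀ x, |F x| ≤ B) :
    kernelIntegral P (midKernel κ κ') F =
      (kernelIntegral P κ F + kernelIntegral P κ' F) / 2 := by
  have h1 : ∀ ω, ∫ p, F (ω, p) ∂(midKernel κ κ' ω) =
      2⁻¹ * (∫ p, F (ω, p) ∂(κ ω) + ∫ p, F (ω, p) ∂(κ' ω)) := by
    intro ω
    have hm : Measurable fun p => F (ω, p) := hF.comp measurable_prodMk_left
    rw [midKernel_apply, integral_smul_measure, integral_add_measure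
      (integrable_of_abs_le hm fun p => hB (ω, p)) (integrable_of_abs_le hm fun p => hB (ω, p))]
    simp
  simp only [kernelIntegral, h1]
  rw [integral_const_mul, integral_add
    (integrable_of_abs_le (measurable_integral_kernel κ hF) (abs_integral_kernel_le κ hB))
    (integrable_of_abs_le (measurable_integral_kernel κ' hF) (abs_integral_kernel_le κ' hB))]
  ring

/-- Weak convergence in almost every fibre combines with dominated convergence over Ω, so test
functions need continuity in the fibre variable only. -/
theorem tendsto_kernelIntegral [IsProbabilityMeasure P] [TopologicalSpace M] [BorelSpace M]
    {κ : ℕ → Kernel Ω M} (hκ : ∀ n, IsMarkovKernel (κ n)) {κ' : Kernel Ω M}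
    (h : ∀ᵐ ω ∂P, ∀ f : M →ᵇ ℝ,
      Tendsto (fun n => ∫ x, f x ∂(κ n ω)) atTop (𝓝 (∫ x, f x ∂(κ' ω))))
    {F : Ω × M → ℝ} (hF : Measurable F) (hFc : ∀ ω, Continuous fun p => F (ω, p)) {B : ℝ}
    (hB : ∀ x, |F x| ≤ B) :
    Tendsto (fun n => kernelIntegral P (κ n) F) atTop (𝓝 (kernelIntegral P κ' F)) := by
  refine tendsto_integral_of_dominated_convergence (fun _ => B)
    (fun n => (measurable_integral_kernel (κ n) hF).aestronglyMeasurable) (integrable_const _)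
    (fun n => ae_of_all _ fun ω => abs_integral_kernel_le (κ n) hB ω) ?_
  filter_upwards [h] with ω hω
  exact hω (BoundedContinuousFunction.ofNormedAddCommGroup (fun p => F (ω, p)) (hFc ω) B
    fun p => hB (ω, p))

/-- The average of the Dirac measures at finitely many random points. -/
noncomputable def averageKernel (n : ℕ) (z : ℕ → Ω → M) (hz : ∀ i, Measurable (z i)) :
    Kernel Ω M where
  toFun ω := (n : ℝ≥0∞)⁻¹ • ∑ i ∈ Finset.range n, Measure.dirac (z i ω)
  measurable' := by
    refine Measure.measurable_of_measurable_coe _ fun s hs => ?_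
    simp only [Measure.smul_apply, Measure.finsetSum_apply]
    refine (Finset.measurable_fun_sum _ fun i _ => ?_).const_smul (n : ℝ≥0∞)⁻¹
    exact (Measure.measurable_coe hs).comp (Measure.measurable_dirac.comp (hz i))

theorem averageKernel_apply (n : ℕ) (z : ℕ → Ω → M) (hz : ∀ i, Measurable (z i)) (ω : Ω) :
    averageKernel n z hz ω = (n : ℝ≥0∞)⁻¹ • ∑ i ∈ Finset.range n, Measure.dirac (z i ω) := rfl

theorem isMarkovKernel_averageKernel {n : ℕ} (hn : 1 ≤ n) (z : ℕ → Ω → M)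
    (hz : ∀ i, Measurable (z i)) : IsMarkovKernel (averageKernel n z hz) := by
  refine ⟨fun ω => ⟨?_⟩⟩
  simp only [averageKernel_apply, Measure.smul_apply, Measure.finsetSum_apply, measure_univ,
    Finset.sum_const, Finset.card_range, nsmul_eq_mul, mul_one, smul_eq_mul]
  exact ENNReal.inv_mul_cancel (by simp; omega) (by simp)

theorem integral_averageKernel (n : ℕ) (z : ℕ → Ω → M) (hz : ∀ i, Measurable (z i)) (ω : Ω)
    {f : M → ℝ} (hf : Measurable f) {B : ℝ} (hB : ∀ p, |f p| ≤ B) :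
    ∫ p, f p ∂(averageKernel n z hz ω) = (n : ℝ)⁻¹ * ∑ i ∈ Finset.range n, f (z i ω) := by
  rw [averageKernel_apply, integral_smul_measure, integral_finsetSum_measure
    fun i _ => integrable_of_abs_le hf hB]
  simp [integral_dirac' _ _ hf.stronglyMeasurable]

theorem ae_averageKernel {n : ℕ} (z : ℕ → Ω → M) (hz : ∀ i, Measurable (z i)) {ω : Ω}
    {p : M → Prop} (hp : MeasurableSet {x | p x}) (h : ∀ i < n, p (z i ω)) :
    ∀ᵐ x ∂(averageKernel n z hz ω), p x := by
  rw [averageKernel_apply]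
  refine Measure.ae_smul_measure ?_ _
  rw [ae_iff, Measure.finsetSum_apply]
  refine Finset.sum_eq_zero fun i hi => ?_
  rw [← ae_iff, ae_dirac_iff hp]
  exact h i (Finset.mem_range.1 hi)

end Kernels

/-! ### Approximately invariant kernels -/

namespace DoubleSkewProduct

variable {Ω : Type*} [MeasurableSpace Ω] {P : Measure Ω} {Ξ : Type*} [MetricSpace Ξ]
  [MeasurableSpace Ξ] {d : ℕ}

/-- Subadditivity along orbits in a tube: the derivative of a long iterate is controlled by the
Birkhoff sum of the truncated logarithmic derivative of a short iterate. -/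
theorem ExpansionBound.mul_logJac_le {T : DoubleSkewProduct P Ξ d}
    {K : Set (Ω × Ξ × EuclideanSpace ℝ (Fin d))} {C r : ℝ} (hC : 0 ≤ C)
    (hb : T.ExpansionBound K C r) {n : ℕ} {δ : ℝ} (hδ : δ ≤ r)
    {x : Ω × Ξ × EuclideanSpace ℝ (Fin d)} (hx : x ∈ T.tube K n δ) {m R : ℕ} (hm : 1 ≤ m)
    (hmn : m ≤ n) (hR : R ≤ n) (B : ℝ) :
    m * T.logJac ((n : ℝ) ^ 2) B n x ≤
      2 * m * m * C + m * R + ∑ i ∈ Finset.range n, T.logJac R (m * C) m (T.map^[i] x) := by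
  set φ : ℕ → ℝ := fun i => T.logJac R (m * C) m (T.map^[i] x) with hφ
  have hφR : ∀ i, -(R : ℝ) ≤ φ i := fun i => T.neg_le_logJac _ _ _ _
  set G : ℝ := 2 * m * m * C + m * R + ∑ i ∈ Finset.range n, φ i with hG
  obtain ⟨k, rfl⟩ := Nat.exists_eq_add_of_le' hmn
  have hE : 1 ≤ Real.exp C := Real.one_le_exp hC
  have hmpos : (0 : ℝ) < m := by exact_mod_cast hm
  have hm1 : (1 : ℝ) ≤ m := by exact_mod_cast hm
  have hjac : T.jac (k + m) x ^ m ≤ Real.exp G := by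
    refine (pow_le_mul_prod_of_block (a := fun i => T.jac i x) (q := fun i => Real.exp (φ i)) hE
      (fun i => T.jac_nonneg _ _) (fun i => (Real.exp_pos _).le) hm (fun i hi => ?_)
      (fun i hi => ?_)).trans ?_
    · refine (T.jac_add_le i 1 x).trans ?_
      gcongr
      · exact T.jac_nonneg _ _
      · simpa using hb.jac_le hδ hx i 1 (by omega)
    · refine (T.jac_add_le i m x).trans ?_
      gcongr
      · exact T.jac_nonneg _ _
      · exact T.jac_le_exp_logJac (hb.jac_le hδ hx i m (by omega))
    · have h0 : T.jac 0 x ^ m ≤ 1 := pow_le_one₀ (T.jac_nonneg _ _) (T.jac_zero_le x)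
      -- The block estimate covers only the first k = n - m times; completing the Birkhoff sum costs
      -- at most R for each of the m missing terms.
      have h1 : -(m * R : ℝ) ≤ ∑ i ∈ Finset.range m, φ (k + i) := by
        calc -(m * R : ℝ) = ∑ i ∈ Finset.range m, -(R : ℝ) := by simp
          _ ≤ _ := Finset.sum_le_sum fun i _ => hφR _
      rw [← Real.exp_sum]
      calc Real.exp C ^ (2 * m * m) * T.jac 0 x ^ m * Real.exp (∑ i ∈ Finset.range k, φ i)
          ≤ Real.exp C ^ (2 * m * m) * 1 * Real.exp (∑ i ∈ Finset.range k, φ i) := by gcongr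
        _ = Real.exp (2 * m * m * C + ∑ i ∈ Finset.range k, φ i) := by
            rw [mul_one, Real.exp_add, ← Real.exp_nat_mul]; push_cast; rfl
        _ ≤ Real.exp G := by
            refine Real.exp_le_exp.2 ?_
            rw [hG, Finset.sum_range_add]
            linarith
  -- The truncation level n² on the left must lie below the average on the right; R ≤ n ensures
  -- this.
  have hGlow : -(m * ((k + m : ℕ) : ℝ) ^ 2) ≤ G := by
    have h1 : -(((k + m : ℕ) : ℝ) * R) ≤ ∑ i ∈ Finset.range (k + m), φ i := by
      calc -(((k + m : ℕ) : ℝ) * R) = ∑ i ∈ Finset.range (k + m), -(R : ℝ) := by simp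
        _ ≤ _ := Finset.sum_le_sum fun i _ => hφR _
    have h2 : (R : ℝ) ≤ ((k + m : ℕ) : ℝ) := by exact_mod_cast hR
    have h3 : ((k + m : ℕ) : ℝ) * R ≤ m * ((k + m : ℕ) : ℝ) ^ 2 := by
      have h4 : ((k + m : ℕ) : ℝ) * R ≤ ((k + m : ℕ) : ℝ) * ((k + m : ℕ) : ℝ) := by gcongr
      nlinarith [sq_nonneg (((k + m : ℕ) : ℝ))]
    have h5 : (0 : ℝ) ≤ 2 * m * m * C + m * R := by positivity
    linarith
  rw [← Real.exp_le_exp, Real.exp_nat_mul, exp_logJac]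
  rcases le_total (min (T.jac (k + m) x) (Real.exp B)) (Real.exp (-((k + m : ℕ) : ℝ) ^ 2))
    with h | h
  · rw [max_eq_right h, ← Real.exp_nat_mul]
    refine Real.exp_le_exp.2 (le_trans (le_of_eq ?_) hGlow)
    ring
  · rw [max_eq_left h]
    refine le_trans ?_ hjac
    exact pow_le_pow_left₀ (le_min (T.jac_nonneg _ _) (Real.exp_pos _).le) (min_le_left _ _) _

theorem abs_logJac_le (T : DoubleSkewProduct P Ξ d) {R B : ℝ} (hR : 0 ≤ R) (hB : 0 ≤ B) (n : ℕ)
    (x : Ω × Ξ × EuclideanSpace ℝ (Fin d)) : |T.logJac R B n x| ≤ R + B := by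
  have h1 := T.neg_le_logJac R B n x
  have h2 := T.logJac_le (by linarith : -R ≤ B) n x
  rw [abs_le]
  constructor <;> linarith

/-- The point over `ω` on the orbit, started `i` steps earlier, of the random point `s`. -/
def orbitPoint (T : DoubleSkewProduct P Ξ d) (s : Ω → Ξ × EuclideanSpace ℝ (Fin d)) (i : ℕ)
    (ω : Ω) : Ξ × EuclideanSpace ℝ (Fin d) :=
  (T.map^[i] (T.θ.symm^[i] ω, s (T.θ.symm^[i] ω))).2

theorem orbitPoint_iterate (T : DoubleSkewProduct P Ξ d)
    (s : Ω → Ξ × EuclideanSpace ℝ (Fin d)) (i : ℕ) (ω : Ω) :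
    (T.θ^[i] ω, T.orbitPoint s i (T.θ^[i] ω)) = T.map^[i] (ω, s ω) := by
  have h : T.θ.symm^[i] (T.θ^[i] ω) = ω :=
    Function.LeftInverse.iterate (T.θ.symm_apply_apply) i ω
  rw [orbitPoint, h]
  exact Prod.ext (T.map_iterate_fst i (ω, s ω)).symm rfl

/-- Kernels that are almost invariant, almost supported on `K` and whose mean logarithmic
expansion is almost nonnegative. -/
def approxKernels (T : DoubleSkewProduct P Ξ d) (K : Set (Ω × Ξ × EuclideanSpace ℝ (Fin d)))
    (C : ℝ) (N : ℕ) : Set (Kernel Ω (Ξ × EuclideanSpace ℝ (Fin d))) :=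
  {κ | IsMarkovKernel κ ∧
    (∀ᵐ ω ∂P, ∀ᵐ p ∂(κ ω), Metric.infEDist p (fiber K ω) ≤ ENNReal.ofReal (1 / ((N : ℝ) + 1))) ∧
    (∀ (F : Ω × Ξ × EuclideanSpace ℝ (Fin d) → ℝ) (B : ℝ), 0 ≤ B → Measurable F → (∀ x, |F x| ≤ B) →
      |kernelIntegral P κ (fun x => F (T.map x)) - kernelIntegral P κ F| ≤
        2 * B * (1 / ((N : ℝ) + 1))) ∧
    ∀ m R : ℕ, 1 ≤ m → m ≤ N → R ≤ N →
      -((m + 2 * m * m * C + m * R) * (1 / ((N : ℝ) + 1))) ≤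
        kernelIntegral P κ (T.logJac R (m * C) m)}

theorem antitone_approxKernels (T : DoubleSkewProduct P Ξ d)
    (K : Set (Ω × Ξ × EuclideanSpace ℝ (Fin d))) {C : ℝ} (hC : 0 ≤ C) :
    Antitone (T.approxKernels K C) := by
  intro n n' hn κ hκ
  have hle : 1 / ((n' : ℝ) + 1) ≤ 1 / ((n : ℝ) + 1) := by gcongr
  refine ⟨hκ.1, ?_, fun F B hB0 hF hB => (hκ.2.2.1 F B hB0 hF hB).trans ?_, fun m R hm hmN hRN =>
    le_trans ?_ (hκ.2.2.2 m R hm (hmN.trans hn) (hRN.trans hn))⟩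
  · filter_upwards [hκ.2.1] with ω hω
    filter_upwards [hω] with p hp
    exact hp.trans (ENNReal.ofReal_le_ofReal hle)
  · gcongr
  · gcongr

variable [CompactSpace Ξ] [BorelSpace Ξ]

theorem measurable_orbitPoint (T : DoubleSkewProduct P Ξ d)
    {s : Ω → Ξ × EuclideanSpace ℝ (Fin d)} (hs : Measurable s) (i : ℕ) :
    Measurable (T.orbitPoint s i) :=
  measurable_snd.comp ((T.measurable_map.iterate i).comp
    ((T.θ.symm.measurable.iterate i).prodMk (hs.comp (T.θ.symm.measurable.iterate i))))

theorem measurableSet_tube (T : DoubleSkewProduct P Ξ d)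
    {K : Set (Ω × Ξ × EuclideanSpace ℝ (Fin d))} (hK : IsRandomCompact K) (n : ℕ) (δ : ℝ) :
    MeasurableSet (T.tube K n δ) := by
  have : T.tube K n δ = ⋂ i ∈ Finset.range (n + 1),
      {x | Metric.infEDist (T.map^[i] x).2 (fiber K (T.map^[i] x).1) < ENNReal.ofReal δ} := by
    ext x
    simp only [tube, mem_ofPred_eq, Finset.mem_range, mem_iInter, Nat.lt_succ_iff]
  rw [this]
  refine Finset.measurableSet_biInter _ fun i _ => ?_
  exact measurableSet_lt (hK.measurable_infEDist_prod.comp (T.measurable_map.iterate i))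
    measurable_const

/-- The empirical kernel along the orbit of a random point. -/
noncomputable def orbitKernel (T : DoubleSkewProduct P Ξ d)
    {s : Ω → Ξ × EuclideanSpace ℝ (Fin d)} (hs : Measurable s) (n : ℕ) :
    Kernel Ω (Ξ × EuclideanSpace ℝ (Fin d)) :=
  averageKernel n (T.orbitPoint s) (T.measurable_orbitPoint hs)

/-- The i-th atom over ω is reached from θ^{-i} ω; invariance of P moves the integration back to the
starting point. -/
theorem kernelIntegral_orbitKernel [IsProbabilityMeasure P] (T : DoubleSkewProduct P Ξ d)
    {s : Ω → Ξ × EuclideanSpace ℝ (Fin d)} (hs : Measurable s) (n : ℕ)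
    {F : Ω × Ξ × EuclideanSpace ℝ (Fin d) → ℝ} (hF : Measurable F) {B : ℝ}
    (hB : ∀ x, |F x| ≤ B) :
    kernelIntegral P (T.orbitKernel hs n) F =
      (n : ℝ)⁻¹ * ∑ i ∈ Finset.range n, ∫ ω, F (T.map^[i] (ω, s ω)) ∂P := by
  have h1 : ∀ ω, ∫ p, F (ω, p) ∂(T.orbitKernel hs n ω) =
      (n : ℝ)⁻¹ * ∑ i ∈ Finset.range n, F (ω, T.orbitPoint s i ω) := fun ω =>
    integral_averageKernel n _ _ ω (f := fun p => F (ω, p)) (hF.comp measurable_prodMk_left)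
      fun p => hB (ω, p)
  have hm : ∀ i, Measurable fun ω => F (ω, T.orbitPoint s i ω) := fun i =>
    hF.comp (measurable_id.prodMk (T.measurable_orbitPoint hs i))
  simp only [kernelIntegral, h1]
  rw [integral_const_mul, integral_finsetSum _ fun i _ => integrable_of_abs_le (hm i) fun ω => hB _]
  congr 1
  refine Finset.sum_congr rfl fun i _ => ?_
  have hmp := T.ergodic_θ.toMeasurePreserving.iterate i
  have h2 := integral_map (μ := P) hmp.measurable.aemeasurable
    (f := fun ω => F (ω, T.orbitPoint s i ω)) (hm i).aestronglyMeasurable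
  rw [hmp.map_eq] at h2
  rw [h2]
  simp_rw [orbitPoint_iterate]

/-- Kernel integrals are affine in the kernel, so each defining condition is preserved under
averaging. This is the closure property used for the Hilbert space selection. -/
theorem midKernel_mem_approxKernels [IsProbabilityMeasure P] (T : DoubleSkewProduct P Ξ d)
    {K : Set (Ω × Ξ × EuclideanSpace ℝ (Fin d))} {C : ℝ} (hC : 0 ≤ C) {N : ℕ}
    {κ κ' : Kernel Ω (Ξ × EuclideanSpace ℝ (Fin d))} (hκ : κ ∈ T.approxKernels K C N)
    (hκ' : κ' ∈ T.approxKernels K C N) : midKernel κ κ' ∈ T.approxKernels K C N := by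
  obtain ⟨h1, h2, h3, h4⟩ := hκ
  obtain ⟨h1', h2', h3', h4'⟩ := hκ'
  refine ⟨isMarkovKernel_midKernel κ κ', ?_, fun F B hB0 hF hB => ?_, fun m R hm hmN hRN => ?_⟩
  · filter_upwards [h2, h2'] with ω hω hω'
    rw [midKernel_apply]
    exact Measure.ae_smul_measure (ae_add_measure_iff.2 ⟨hω, hω'⟩) _
  · have hFT : Measurable fun x => F (T.map x) := hF.comp T.measurable_map
    rw [kernelIntegral_midKernel κ κ' hF hB, kernelIntegral_midKernel κ κ' hFT fun x => hB _]
    have e1 := abs_le.1 (h3 F B hB0 hF hB)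
    have e2 := abs_le.1 (h3' F B hB0 hF hB)
    rw [abs_le]
    constructor <;> linarith [e1.1, e1.2, e2.1, e2.2]
  · rw [kernelIntegral_midKernel κ κ' (T.measurable_logJac _ _ _)
      (T.abs_logJac_le (Nat.cast_nonneg R) (by positivity) m)]
    linarith [h4 m R hm hmN hRN, h4' m R hm hmN hRN]

/-- The invariance defect telescopes to two boundary terms divided by N + 1. In the expansion
defect, the summand m comes from the mean bound -1, and the rest from the error in
`ExpansionBound.mul_logJac_le`. -/
theorem orbitKernel_mem_approxKernels [IsProbabilityMeasure P] {T : DoubleSkewProduct P Ξ d}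
    {K : Set (Ω × Ξ × EuclideanSpace ℝ (Fin d))} {C r : ℝ} (hC : 0 ≤ C)
    (hb : T.ExpansionBound K C r) {N : ℕ} {δ : ℝ} (hδ : δ ≤ r) (hδN : δ ≤ 1 / ((N : ℝ) + 1))
    {s : Ω → Ξ × EuclideanSpace ℝ (Fin d)} (hs : Measurable s)
    (htube : ∀ᵐ ω ∂P, (ω, s ω) ∈ T.tube K (N + 1) δ)
    (hmean : -1 ≤ ∫ ω, T.logJac (((N + 1 : ℕ) : ℝ) ^ 2) ((N + 1 : ℕ) * C) (N + 1) (ω, s ω) ∂P) :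
    T.orbitKernel hs (N + 1) ∈ T.approxKernels K C N := by
  have hsm : ∀ i, Measurable fun ω => T.map^[i] (ω, s ω) := fun i =>
    (T.measurable_map.iterate i).comp (measurable_id.prodMk hs)
  have hNpos : (0 : ℝ) < (N : ℝ) + 1 := by positivity
  refine ⟨isMarkovKernel_averageKernel (by omega) _ _, ?_, fun F B hB0 hF hB => ?_,
    fun m R hm hmN hRN => ?_⟩
  · have hsymm : MeasurePreserving T.θ.symm P P := T.ergodic_θ.toMeasurePreserving.symm
    have h1 : ∀ᵐ ω ∂P, ∀ i : ℕ,
        (T.θ.symm^[i] ω, s (T.θ.symm^[i] ω)) ∈ T.tube K (N + 1) δ :=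
      ae_all_iff.2 fun i => (hsymm.iterate i).quasiMeasurePreserving.ae htube
    filter_upwards [h1] with ω hω
    refine ae_averageKernel _ _ ?_ fun i hi => ?_
    · exact measurableSet_le Metric.continuous_infEDist.measurable measurable_const
    · have h2 := hω i i hi.le
      have h3 : (T.map^[i] (T.θ.symm^[i] ω, s (T.θ.symm^[i] ω))).1 = ω := by
        rw [map_iterate_fst]
        exact Function.LeftInverse.iterate (T.θ.apply_symm_apply) i ω
      rw [h3] at h2
      exact h2.le.trans (ENNReal.ofReal_le_ofReal hδN)
  · have hFT : Measurable fun x => F (T.map x) := hF.comp T.measurable_map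
    rw [T.kernelIntegral_orbitKernel hs _ hF hB,
      T.kernelIntegral_orbitKernel hs _ hFT fun x => hB _, ← mul_sub, ← Finset.sum_sub_distrib]
    simp_rw [← Function.iterate_succ_apply' T.map]
    rw [Finset.sum_range_sub (fun i => ∫ ω, F (T.map^[i] (ω, s ω)) ∂P)]
    have hI : ∀ i, |∫ ω, F (T.map^[i] (ω, s ω)) ∂P| ≤ B := by
      intro i
      have := norm_integral_le_of_norm_le_const (μ := P) (C := B)
        (f := fun ω => F (T.map^[i] (ω, s ω))) (ae_of_all _ fun ω => hB _)
      simpa using this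
    rw [abs_mul, abs_of_nonneg (by positivity), mul_comm]
    push_cast
    rw [one_div]
    gcongr
    calc _ ≤ |∫ ω, F (T.map^[N + 1] (ω, s ω)) ∂P| + |∫ ω, F (T.map^[0] (ω, s ω)) ∂P| :=
          abs_sub _ _
      _ ≤ 2 * B := by linarith [hI (N + 1), hI 0]
  · set n := N + 1 with hn
    have hφB := T.abs_logJac_le (Nat.cast_nonneg R) (by positivity : 0 ≤ (m : ℝ) * C) m
    rw [T.kernelIntegral_orbitKernel hs _ (T.measurable_logJac _ _ _) hφB]
    have hint : ∀ i, Integrable (fun ω => T.logJac R (m * C) m (T.map^[i] (ω, s ω))) P :=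
      fun i => integrable_of_abs_le ((T.measurable_logJac _ _ _).comp (hsm i)) fun ω => hφB _
    have hle : ∫ ω, m * T.logJac ((n : ℝ) ^ 2) (n * C) n (ω, s ω) ∂P ≤
        ∫ ω, (2 * m * m * C + m * R +
          ∑ i ∈ Finset.range n, T.logJac R (m * C) m (T.map^[i] (ω, s ω))) ∂P := by
      refine integral_mono_ae ?_ ?_ ?_
      · refine Integrable.const_mul (integrable_of_abs_le
          ((T.measurable_logJac _ _ _).comp (hsm 0)) fun ω =>
            T.abs_logJac_le (by positivity) (by positivity) _ _) _
      · exact (integrable_const _).add (integrable_finsetSum _ fun i _ => hint i)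
      · filter_upwards [htube] with ω hω
        exact hb.mul_logJac_le hC hδ hω hm (by omega) (by omega) _
    rw [integral_const_mul, integral_add (integrable_const _)
      (integrable_finsetSum _ fun i _ => hint i), integral_finsetSum _ fun i _ => hint i] at hle
    simp only [integral_const, probReal_univ, one_smul] at hle
    have hmpos : (0 : ℝ) ≤ m := Nat.cast_nonneg m
    have h5 : -(m : ℝ) ≤ m * ∫ ω, T.logJac ((n : ℝ) ^ 2) (n * C) n (ω, s ω) ∂P := by
      have := mul_le_mul_of_nonneg_left hmean hmpos
      linarith
    have hncast : (n : ℝ) = (N : ℝ) + 1 := by rw [hn]; push_cast; rfl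
    rw [hncast, one_div, mul_comm _ ((N : ℝ) + 1)⁻¹, ← mul_neg]
    gcongr
    linarith

end DoubleSkewProduct

/-! ### The limiting measure and its exponent -/

theorem continuous_toReal_min_infEDist {M : Type*} [PseudoEMetricSpace M] (s : Set M) :
    Continuous fun p => (min (Metric.infEDist p s) 1).toReal := by
  have h1 : Continuous fun p => min (Metric.infEDist p s) 1 :=
    Metric.continuous_infEDist.min continuous_const
  have h2 : ∀ p, min (Metric.infEDist p s) 1 ∈ {a : ℝ≥0∞ | a ≠ ⊤} := fun p =>
    ne_top_of_le_ne_top ENNReal.one_ne_top (min_le_right _ _)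
  exact ENNReal.continuousOn_toReal.comp_continuous h1 h2

theorem toReal_min_infEDist_le_one {M : Type*} [PseudoEMetricSpace M] (s : Set M) (p : M) :
    (min (Metric.infEDist p s) 1).toReal ≤ 1 := by
  simpa using ENNReal.toReal_mono ENNReal.one_ne_top (min_le_right (Metric.infEDist p s) 1)

theorem measurable_toReal_min_infEDist {Ω M : Type*} [MeasurableSpace Ω] [MetricSpace M]
    [SecondCountableTopology M] [MeasurableSpace M] [BorelSpace M] {K : Set (Ω × M)}
    (hK : IsRandomCompact K) :
    Measurable fun x : Ω × M => (min (Metric.infEDist x.2 (fiber K x.1)) 1).toReal := by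
  have h := hK.measurable_infEDist_prod.min (measurable_const (a := (1 : ℝ≥0∞)))
  exact h.ennreal_toReal

/-- Weak limits of kernels that are asymptotically concentrated near a random compact set are
carried by that set. -/
theorem ae_mem_compProd_of_tendsto {Ω M : Type*} [MeasurableSpace Ω] {P : Measure Ω}
    [IsProbabilityMeasure P] [MetricSpace M] [SecondCountableTopology M] [MeasurableSpace M]
    [BorelSpace M] {K : Set (Ω × M)} (hK : IsRandomCompact K) {κ : ℕ → Kernel Ω M}
    (hmk : ∀ n, IsMarkovKernel (κ n)) {κ' : Kernel Ω M} [IsMarkovKernel κ']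
    (hsupp : ∀ n : ℕ, ∀ᵐ ω ∂P, ∀ᵐ p ∂(κ n ω),
      Metric.infEDist p (fiber K ω) ≤ ENNReal.ofReal (1 / ((n : ℝ) + 1)))
    (hlim : ∀ᵐ ω ∂P, ∀ f : M →ᵇ ℝ,
      Tendsto (fun n => ∫ x, f x ∂(κ n ω)) atTop (𝓝 (∫ x, f x ∂(κ' ω)))) :
    ∀ᵐ x ∂(P ⊗ₘ κ'), x ∈ K := by
  -- Capping at 1 gives a bounded test function, also over empty fibres, where the distance is
  -- infinite.
  set F : Ω × M → ℝ :=
    fun x => (min (Metric.infEDist x.2 (fiber K x.1)) 1).toReal with hF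
  have hFm : Measurable F := measurable_toReal_min_infEDist hK
  have hFc : ∀ ω, Continuous fun p => F (ω, p) := fun ω =>
    continuous_toReal_min_infEDist (fiber K ω)
  have hF0 : ∀ x, 0 ≤ F x := fun x => ENNReal.toReal_nonneg
  have hFB : ∀ x, |F x| ≤ 1 := fun x => by
    rw [abs_of_nonneg (hF0 x)]
    exact toReal_min_infEDist_le_one _ _
  have hle : ∀ n : ℕ, kernelIntegral P (κ n) F ≤ 1 / ((n : ℝ) + 1) := by
    intro n
    have h1 : ∀ᵐ ω ∂P, ∫ p, F (ω, p) ∂(κ n ω) ≤ 1 / ((n : ℝ) + 1) := by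
      filter_upwards [hsupp n] with ω hω
      calc ∫ p, F (ω, p) ∂(κ n ω) ≤ ∫ p, 1 / ((n : ℝ) + 1) ∂(κ n ω) := by
            refine integral_mono_ae (integrable_of_abs_le (hFc ω).measurable fun p => hFB (ω, p))
              (integrable_const _) ?_
            filter_upwards [hω] with p hp
            exact ENNReal.toReal_le_of_le_ofReal (by positivity) ((min_le_left _ _).trans hp)
        _ = 1 / ((n : ℝ) + 1) := by simp
    calc kernelIntegral P (κ n) F ≤ ∫ ω, 1 / ((n : ℝ) + 1) ∂P :=
          integral_mono_ae (integrable_of_abs_le (measurable_integral_kernel _ hFm)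
            (abs_integral_kernel_le _ hFB)) (integrable_const _) h1
      _ = 1 / ((n : ℝ) + 1) := by simp
  have hzero : ∫ x, F x ∂(P ⊗ₘ κ') = 0 := by
    rw [integral_compProd_eq_kernelIntegral κ' hFm hFB]
    refine le_antisymm (le_of_tendsto_of_tendsto' (tendsto_kernelIntegral hmk hlim hFm hFc hFB)
      tendsto_one_div_add_atTop_nhds_zero_nat hle) ?_
    exact integral_nonneg fun ω => integral_nonneg fun p => hF0 _
  have hae := (integral_eq_zero_iff_of_nonneg hF0 (integrable_of_abs_le hFm hFB)).1 hzero
  filter_upwards [hae] with x hx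
  rw [hK.mem_iff_infEDist]
  have h1 : (min (Metric.infEDist x.2 (fiber K x.1)) 1).toReal = 0 := hx
  rcases (ENNReal.toReal_eq_zero_iff _).1 h1 with h | h
  · rcases min_eq_iff.1 h with h' | h'
    · exact h'.1
    · exact absurd h'.1 one_ne_zero
  · exact absurd h (ne_top_of_le_ne_top ENNReal.one_ne_top (min_le_right _ _))

namespace DoubleSkewProduct

variable {Ω : Type*} [MeasurableSpace Ω] {P : Measure Ω} {Ξ : Type*} [MetricSpace Ξ]
  [MeasurableSpace Ξ] {d : ℕ}

/-- Truncation below leaves the positive part unchanged and caps the negative part at R; these are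
the two inequalities needed to pass to the extended integral. -/
theorem ofReal_logJac_le (T : DoubleSkewProduct P Ξ d) (R : ℕ) (B : ℝ) (m : ℕ)
    {x : Ω × Ξ × EuclideanSpace ℝ (Fin d)} (hx : T.jac m x ≤ Real.exp B) :
    ENNReal.ofReal (T.logJac R B m x) ≤ (T.Phi m x).toENNReal ∧
      min (-T.Phi m x).toENNReal R ≤ ENNReal.ofReal (-T.logJac R B m x) := by
  have hφ : T.logJac R B m x = Real.log (max (T.jac m x) (Real.exp (-R))) := by
    rw [logJac, min_eq_left hx]
  rcases (T.jac_nonneg m x).eq_or_lt with h0 | hpos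
  · have h1 : T.logJac R B m x = -R := by
      rw [hφ, ← h0, max_eq_right (Real.exp_pos _).le, Real.log_exp]
    rw [h1]
    constructor
    · rw [ENNReal.ofReal_of_nonpos (by simp)]; exact bot_le
    · rw [neg_neg, ENNReal.ofReal_natCast]; exact min_le_right _ _
  · have hΦ : T.Phi m x = ((Real.log (T.jac m x) : ℝ) : EReal) := by
      rw [Phi_eq, ENNReal.log_ofReal_of_pos hpos]
    have h1 : T.logJac R B m x = max (Real.log (T.jac m x)) (-R) := by
      rw [hφ]
      rcases le_total (T.jac m x) (Real.exp (-R)) with h | h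
      · have := Real.log_le_log hpos h
        rw [Real.log_exp] at this
        rw [max_eq_right h, max_eq_right this, Real.log_exp]
      · have := Real.log_le_log (Real.exp_pos _) h
        rw [Real.log_exp] at this
        rw [max_eq_left h, max_eq_left this]
    rw [hΦ, h1, ← EReal.coe_neg, EReal.toENNReal_of_ne_top (EReal.coe_ne_top _),
      EReal.toENNReal_of_ne_top (EReal.coe_ne_top _), EReal.toReal_coe, EReal.toReal_coe]
    constructor
    · rcases le_total (Real.log (T.jac m x)) (-R) with h | h
      · rw [max_eq_right h, ENNReal.ofReal_of_nonpos (by simp)]; exact bot_le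
      · rw [max_eq_left h]
    · rcases le_total (Real.log (T.jac m x)) (-R) with h | h
      · rw [max_eq_right h, neg_neg, ENNReal.ofReal_natCast]; exact min_le_right _ _
      · rw [max_eq_left h]; exact min_le_left _ _

variable [CompactSpace Ξ] [BorelSpace Ξ]

/-- Weak limits of asymptotically invariant kernels are invariant. -/
theorem map_compProd_eq_of_tendsto [IsProbabilityMeasure P] (T : DoubleSkewProduct P Ξ d)
    {κ : ℕ → Kernel Ω (Ξ × EuclideanSpace ℝ (Fin d))} (hmk : ∀ n, IsMarkovKernel (κ n))
    {κ' : Kernel Ω (Ξ × EuclideanSpace ℝ (Fin d))} [IsMarkovKernel κ']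
    (hinv : ∀ (n : ℕ) (F : Ω × Ξ × EuclideanSpace ℝ (Fin d) → ℝ) (B : ℝ), 0 ≤ B →
      Measurable F → (∀ x, |F x| ≤ B) →
      |kernelIntegral P (κ n) (fun x => F (T.map x)) - kernelIntegral P (κ n) F| ≤
        2 * B * (1 / ((n : ℝ) + 1)))
    (hlim : ∀ᵐ ω ∂P, ∀ f : (Ξ × EuclideanSpace ℝ (Fin d)) →ᵇ ℝ,
      Tendsto (fun n => ∫ x, f x ∂(κ n ω)) atTop (𝓝 (∫ x, f x ∂(κ' ω)))) :
    (P ⊗ₘ κ').map T.map = P ⊗ₘ κ' := by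
  have : IsProbabilityMeasure ((P ⊗ₘ κ').map T.map) :=
    Measure.isProbabilityMeasure_map T.measurable_map.aemeasurable
  refine Measure.ext_prod fun {A S} hA hS => ?_
  set π : Ω × Ξ × EuclideanSpace ℝ (Fin d) → Ξ × EuclideanSpace ℝ (Fin d) := Prod.snd
  have hπ : Measurable π := measurable_snd
  have hA' : MeasurableSet (Prod.fst ⁻¹' A : Set (Ω × Ξ × EuclideanSpace ℝ (Fin d))) :=
    measurable_fst hA
  -- For fixed A, equality on rectangles becomes equality of two finite measures on Ξ × ℝ^d, which
  -- continuous test functions detect.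
  have hsection : ∀ μ : Measure (Ω × Ξ × EuclideanSpace ℝ (Fin d)),
      μ (A ×ˢ S) = (μ.restrict (Prod.fst ⁻¹' A)).map π S := by
    intro μ
    rw [Measure.map_apply hπ hS, Measure.restrict_apply (hπ hS)]
    congr 1
    ext x
    exact and_comm
  rw [hsection, hsection]
  congr 1
  refine ext_of_forall_integral_eq_of_IsFiniteMeasure fun f => ?_
  have hfm : Measurable f := f.continuous.measurable
  rw [integral_map hπ.aemeasurable hfm.aestronglyMeasurable,
    integral_map hπ.aemeasurable hfm.aestronglyMeasurable, ← integral_indicator hA',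
    ← integral_indicator hA']
  set F : Ω × Ξ × EuclideanSpace ℝ (Fin d) → ℝ :=
    (Prod.fst ⁻¹' A).indicator fun x => f (π x) with hF
  have hFm : Measurable F := (hfm.comp hπ).indicator hA'
  have hFB : ∀ x, |F x| ≤ ‖f‖ := fun x =>
    (norm_indicator_le_norm_self (fun x => f (π x)) x).trans (f.norm_coe_le_norm _)
  have hFc : ∀ ω, Continuous fun p => F (ω, p) := by
    intro ω
    by_cases h : ω ∈ A
    · have : (fun p => F (ω, p)) = fun p => f p := by
        funext p
        exact indicator_of_mem (show (ω, p) ∈ Prod.fst ⁻¹' A from h) _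
      rw [this]; exact f.continuous
    · have : (fun p => F (ω, p)) = fun _ => 0 := by
        funext p
        exact indicator_of_notMem (show (ω, p) ∉ Prod.fst ⁻¹' A from h) _
      rw [this]; exact continuous_const
  have hFTm : Measurable fun x => F (T.map x) := hFm.comp T.measurable_map
  have hFTc : ∀ ω, Continuous fun p => F (T.map (ω, p)) := fun ω =>
    (hFc (T.θ ω)).comp (T.continuous_map_iterate_snd 1 ω)
  rw [integral_map T.measurable_map.aemeasurable hFm.aestronglyMeasurable,
    integral_compProd_eq_kernelIntegral κ' hFTm fun x => hFB _,
    integral_compProd_eq_kernelIntegral κ' hFm hFB, ← sub_eq_zero]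
  have hdiff := (tendsto_kernelIntegral hmk hlim hFTm hFTc fun x => hFB _).sub
    (tendsto_kernelIntegral hmk hlim hFm hFc hFB)
  refine tendsto_nhds_unique hdiff (squeeze_zero_norm
    (fun n => hinv n F ‖f‖ (norm_nonneg f) hFm hFB) ?_)
  simpa using tendsto_one_div_add_atTop_nhds_zero_nat.const_mul (2 * ‖f‖)

/-- Limits of almost invariant kernels yield an invariant measure on `K` with nonnegative mean
logarithmic expansions. -/
theorem exists_mem_invariantMeasures [IsProbabilityMeasure P] [Nonempty Ξ]
    (T : DoubleSkewProduct P Ξ d) {K : Set (Ω × Ξ × EuclideanSpace ℝ (Fin d))}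
    (hK : IsRandomCompact K) {C : ℝ} (hC : 0 ≤ C) (hne : ∀ N, (T.approxKernels K C N).Nonempty) :
    ∃ μ ∈ T.invariantMeasures K, ∀ m R : ℕ, 1 ≤ m → 0 ≤ ∫ x, T.logJac R (m * C) m x ∂μ := by
  obtain ⟨κ, κ', hκ', hκ, hlim⟩ := exists_ae_tendsto_kernel P (T.approxKernels K C)
    (T.antitone_approxKernels K hC) hne (fun κ hκ => hκ.1)
    (fun n κ hκ κ' hκ' => ⟨midKernel κ κ', T.midKernel_mem_approxKernels hC hκ hκ',
      midKernel_apply κ κ'⟩)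
    -- Radius 1 is the support tolerance 1 / (N + 1) at N = 0.
    (Q := fun ω => Metric.cthickening 1 (fiber K ω)) (fun ω => (hK.isCompact_fiber ω).cthickening)
    (fun κ hκ => by
      filter_upwards [hκ.2.1] with ω hω
      rw [← mem_ae_iff]
      filter_upwards [hω] with p hp
      simpa [Metric.mem_cthickening_iff] using hp)
  have hmk : ∀ n, IsMarkovKernel (κ n) := fun n => (hκ n).1
  have hconv : ∀ {F : Ω × Ξ × EuclideanSpace ℝ (Fin d) → ℝ} {B : ℝ}, Measurable F →
      (∀ ω, Continuous fun p => F (ω, p)) → (∀ x, |F x| ≤ B) →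
      Tendsto (fun n => kernelIntegral P (κ n) F) atTop (𝓝 (kernelIntegral P κ' F)) :=
    fun hF hFc hB => tendsto_kernelIntegral hmk hlim hF hFc hB
  have hinvN : Tendsto (fun n : ℕ => 1 / ((n : ℝ) + 1)) atTop (𝓝 0) :=
    tendsto_one_div_add_atTop_nhds_zero_nat
  have hsupport : ∀ᵐ x ∂(P ⊗ₘ κ'), x ∈ K :=
    ae_mem_compProd_of_tendsto hK hmk (fun n => (hκ n).2.1) hlim
  have hmap : (P ⊗ₘ κ').map T.map = P ⊗ₘ κ' :=
    T.map_compProd_eq_of_tendsto hmk (fun n F B hB hF hFB => (hκ n).2.2.1 F B hB hF hFB) hlim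
  refine ⟨P ⊗ₘ κ', ⟨inferInstance, ⟨T.measurable_map, hmap⟩, Measure.fst_compProd P κ', hsupport⟩,
    fun m R hm => ?_⟩
  have hB := T.abs_logJac_le (Nat.cast_nonneg R) (by positivity : 0 ≤ (m : ℝ) * C) m
  have hφm := T.measurable_logJac R (m * C) m
  rw [integral_compProd_eq_kernelIntegral κ' hφm hB]
  have h0 : Tendsto (fun n : ℕ => -((m + 2 * m * m * C + m * R) * (1 / ((n : ℝ) + 1)))) atTop
      (𝓝 0) := by
    simpa using (hinvN.const_mul (m + 2 * m * m * C + m * R)).neg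
  refine le_of_tendsto_of_tendsto h0 (hconv hφm (T.continuous_logJac R (m * C) m) hB) ?_
  filter_upwards [eventually_ge_atTop (max m R)] with n hn
  exact (hκ n).2.2.2 m R hm ((le_max_left _ _).trans hn) ((le_max_right _ _).trans hn)

/-- For each R, the integral of the negative part capped at R is at most that of the positive part,
which the expansion bound makes finite. Monotone convergence in R removes the cap. -/
theorem lyapunov_nonneg {T : DoubleSkewProduct P Ξ d}
    {K : Set (Ω × Ξ × EuclideanSpace ℝ (Fin d))} (hinv : T.IsInvariant K)
    (hconn : HasConnectedFibers P K) {C r : ℝ} (hC : 0 ≤ C) (hr : 0 < r)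
    (hb : T.ExpansionBound K C r) {μ : Measure (Ω × Ξ × EuclideanSpace ℝ (Fin d))}
    (hμ : μ ∈ T.invariantMeasures K)
    (hφ : ∀ m R : ℕ, 1 ≤ m → 0 ≤ ∫ x, T.logJac R (m * C) m x ∂μ) : 0 ≤ T.lyapunov μ := by
  obtain ⟨hprob, -, hfst, hsupp⟩ := hμ
  refine le_iInf fun ⟨m, hm⟩ => EReal.div_nonneg ?_ (by positivity)
  have hjac : ∀ᵐ x ∂μ, T.jac m x ≤ Real.exp (m * C) := by
    have h1 : ∀ᵐ x ∂μ, T.IsRegularPoint K x.1 := by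
      have h2 : ∀ᵐ ω ∂(μ.map Prod.fst), T.IsRegularPoint K ω := by
        rw [hfst]; exact ae_isRegularPoint hinv hconn
      exact ae_of_ae_map measurable_fst.aemeasurable h2
    filter_upwards [h1, hsupp] with x hx hxK
    exact hb.jac_le le_rfl (hx.mem_tube hxK m hr) 0 m (by omega)
  have hmeasΦ : Measurable (T.Phi m) := by
    rw [show T.Phi m = fun x => ENNReal.log (ENNReal.ofReal (T.jac m x)) from
      funext fun x => T.Phi_eq m x]
    exact ENNReal.measurable_log.comp (T.measurable_jac m).ennreal_ofReal
  have hneg_meas : Measurable fun x => (-T.Phi m x).toENNReal :=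
    measurable_ereal_toENNReal.comp (continuous_neg.measurable.comp hmeasΦ)
  set a := ∫⁻ x, (T.Phi m x).toENNReal ∂μ with ha
  set b := ∫⁻ x, (-T.Phi m x).toENNReal ∂μ with hb'
  have ha_top : a ≠ ⊤ := by
    refine ne_top_of_le_ne_top (b := ENNReal.ofReal (m * C)) ENNReal.ofReal_ne_top ?_
    calc a ≤ ∫⁻ x, ENNReal.ofReal (m * C) ∂μ := by
          refine lintegral_mono_ae ?_
          filter_upwards [hjac] with x hx
          have := (T.Phi_le_iff m x (m * C)).2 hx
          refine (EReal.toENNReal_le_toENNReal this).trans_eq ?_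
          rw [EReal.toENNReal_of_ne_top (EReal.coe_ne_top _), EReal.toReal_coe]
      _ = ENNReal.ofReal (m * C) := by simp
  have hR : ∀ R : ℕ, ∫⁻ x, min (-T.Phi m x).toENNReal R ∂μ ≤ a := by
    intro R
    have hφB := T.abs_logJac_le (Nat.cast_nonneg R) (by positivity : 0 ≤ (m : ℝ) * C) m
    have hint : Integrable (T.logJac R (m * C) m) μ :=
      integrable_of_abs_le (T.measurable_logJac R (m * C) m) hφB
    have h1 := hφ m R hm
    rw [integral_eq_lintegral_pos_part_sub_lintegral_neg_part hint, sub_nonneg] at h1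
    calc ∫⁻ x, min (-T.Phi m x).toENNReal R ∂μ
        ≤ ∫⁻ x, ENNReal.ofReal (-T.logJac R (m * C) m x) ∂μ := by
          refine lintegral_mono_ae ?_
          filter_upwards [hjac] with x hx
          exact (T.ofReal_logJac_le R _ m hx).2
      _ ≤ ∫⁻ x, ENNReal.ofReal (T.logJac R (m * C) m x) ∂μ :=
          (ENNReal.toReal_le_toReal hint.neg.lintegral_lt_top.ne hint.lintegral_lt_top.ne).1 h1
      _ ≤ a := by
          refine lintegral_mono_ae ?_
          filter_upwards [hjac] with x hx
          exact (T.ofReal_logJac_le R _ m hx).1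
  have hba : b ≤ a := by
    have hlim : Tendsto (fun R : ℕ => ∫⁻ x, min (-T.Phi m x).toENNReal R ∂μ) atTop (𝓝 b) := by
      refine lintegral_tendsto_of_tendsto_of_monotone
        (fun R => (hneg_meas.min measurable_const).aemeasurable) (ae_of_all _ fun x => ?_)
        (ae_of_all _ fun x => ?_)
      · intro R R' h
        exact min_le_min le_rfl (by exact_mod_cast h)
      · have h1 := (tendsto_const_nhds (x := (-T.Phi m x).toENNReal)).min
          ENNReal.tendsto_nat_nhds_top
        simpa using h1
    exact le_of_tendsto' hlim hR
  change (0 : EReal) ≤ (a : EReal) - (b : EReal)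
  rw [EReal.sub_nonneg (Or.inl (by simpa using ha_top)) (Or.inl (by simp))]
  exact_mod_cast hba

/-- Negativity of all Lyapunov exponents yields a negative mean expansion in a tube around `K`. -/
theorem exists_integral_neg [IsProbabilityMeasure P] [Nonempty Ξ] {T : DoubleSkewProduct P Ξ d}
    {K : Set (Ω × Ξ × EuclideanSpace ℝ (Fin d))} (hK : IsRandomCompact K)
    (hinv : T.IsInvariant K) (hconn : HasConnectedFibers P K) {C r : ℝ} (hC : 0 ≤ C) (hr : 0 < r)
    (hb : T.ExpansionBound K C r) (hlyap : ∀ μ ∈ T.invariantMeasures K, T.lyapunov μ < 0) :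
    ∃ (m : ℕ) (δ R : ℝ) (c : Ω → ℝ), 1 ≤ m ∧ 0 < δ ∧ δ ≤ r ∧
      (∀ x ∈ T.tube K m δ, T.logJac R (m * C) m x ≤ c x.1) ∧ Measurable c ∧ Integrable c P ∧
      ∫ ω, c ω ∂P < 0 := by
  by_contra hcon
  have hne : ∀ N, (T.approxKernels K C N).Nonempty := by
    intro N
    set δ := min r (1 / ((N : ℝ) + 1)) with hδ
    have hδ0 : 0 < δ := lt_min hr (by positivity)
    have hnonneg : (0 : ℝ) ≤ ((N + 1 : ℕ) : ℝ) * C := by positivity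
    have hsq : (0 : ℝ) ≤ ((N + 1 : ℕ) : ℝ) ^ 2 := by positivity
    obtain ⟨c, hcm, hcb, hcU, s, hs, hsel⟩ := exists_measurable_sup_and_selection
      (U := T.tube K (N + 1) δ) (φ := T.logJac (((N + 1 : ℕ) : ℝ) ^ 2) ((N + 1 : ℕ) * C) (N + 1))
      (fun p => (T.measurableSet_tube hK (N + 1) δ).preimage measurable_prodMk_right)
      (T.isOpen_tube_fiber K (N + 1) δ)
      (fun p => (T.measurable_logJac _ _ _).comp measurable_prodMk_right)
      (T.continuous_logJac _ _ _) (T.neg_le_logJac _ _ _) (T.logJac_le (by linarith) _)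
    have hci : Integrable c P := by
      refine integrable_of_abs_le hcm (B := ((N + 1 : ℕ) : ℝ) ^ 2 + (N + 1 : ℕ) * C) fun ω => ?_
      rw [abs_le]
      constructor <;> linarith [(hcb ω).1, (hcb ω).2]
    -- A negative mean would realize the denied conclusion with m = N + 1. The truncation level (N +
    -- 1)² is the one required by `ExpansionBound.mul_logJac_le`.
    have hc0 : 0 ≤ ∫ ω, c ω ∂P := by
      by_contra hlt
      exact hcon ⟨N + 1, δ, ((N + 1 : ℕ) : ℝ) ^ 2, c, by omega, hδ0, min_le_left _ _,
        fun x hx => hcU x.1 x.2 hx, hcm, hci, not_le.1 hlt⟩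
    have hgood : ∀ᵐ ω ∂P, (ω, s ω) ∈ T.tube K (N + 1) δ ∧
        c ω - 1 < T.logJac (((N + 1 : ℕ) : ℝ) ^ 2) ((N + 1 : ℕ) * C) (N + 1) (ω, s ω) := by
      filter_upwards [ae_isRegularPoint hinv hconn] with ω hω
      obtain ⟨y, hy⟩ := ((hω 0).2 (Classical.arbitrary Ξ)).nonempty
      exact hsel ω ⟨(Classical.arbitrary Ξ, y), hω.mem_tube (x := (ω, Classical.arbitrary Ξ, y))
        hy (N + 1) hδ0⟩
    refine ⟨_, orbitKernel_mem_approxKernels hC hb (min_le_left _ _) (min_le_right _ _) hs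
      (hgood.mono fun ω h => h.1) ?_⟩
    calc (-1 : ℝ) ≤ ∫ ω, (c ω - 1) ∂P := by
          rw [integral_sub hci (integrable_const _)]; simp; linarith
      _ ≤ _ := by
          refine integral_mono_ae (hci.sub (integrable_const _)) ?_ (hgood.mono fun ω h => h.2.le)
          exact integrable_of_abs_le
            ((T.measurable_logJac _ _ _).comp (measurable_id.prodMk hs))
            fun ω => T.abs_logJac_le hsq hnonneg _ _
  obtain ⟨μ, hμ, hφ⟩ := T.exists_mem_invariantMeasures hK hC hne
  exact absurd (hlyap μ hμ) (not_lt.2 (lyapunov_nonneg hinv hconn hC hr hb hμ hφ))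

end DoubleSkewProduct

end RandomForcing

theorem theorem3p3 {Ω : Type*} [MeasurableSpace Ω] (P : MeasureTheory.Measure Ω)
    [MeasureTheory.IsProbabilityMeasure P]
    {Ξ : Type*} [MetricSpace Ξ] [CompactSpace Ξ] [MeasurableSpace Ξ] [BorelSpace Ξ]
    {d : ℕ} (T : RandomForcing.DoubleSkewProduct P Ξ d)
    (K : Set (Ω × Ξ × EuclideanSpace ℝ (Fin d)))
    (hK : RandomForcing.IsRandomCompact K)
    (hKinv : T.IsInvariant K)
    (hKconn : RandomForcing.DoubleSkewProduct.HasConnectedFibers P K)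
    (hfin : (⨆ (ω : Ω) (p ∈ RandomForcing.fiber K ω), T.Phi 1 (ω, p)) < ⊤)
    (hunif : T.UniformDerivative K)
    (hlyap : ∀ μ ∈ T.invariantMeasures K, T.lyapunov μ < 0) :
    ∃ φ : Ω × Ξ → EuclideanSpace ℝ (Fin d),
      RandomForcing.IsRandomContinuous φ ∧
      ∀ᵐ ω ∂P, RandomForcing.fiber K ω = {p | ∃ ξ : Ξ, p = (ξ, φ (ω, ξ))} := by
  refine RandomForcing.exists_isRandomContinuous_of_subsingleton hK
    (hKconn.mono fun ω h ξ => (h ξ).nonempty) ?_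
  -- The measurable selection needs a point of Ξ; for empty Ξ the claim is vacuous.
  rcases isEmpty_or_nonempty Ξ with hΞ | hΞ
  · exact ae_of_all _ fun ω ξ => isEmptyElim ξ
  · obtain ⟨C, r, hC, hr, hb⟩ :=
      RandomForcing.DoubleSkewProduct.UniformDerivative.exists_expansionBound hfin hunif
    obtain ⟨m, δ, R, c, hm, hδ0, hδ, hc, hcm, hci, hneg⟩ :=
      RandomForcing.DoubleSkewProduct.exists_integral_neg hK hKinv hKconn hC hr hb hlyap
    exact hb.ae_subsingleton hK hKinv hKconn hC hm hδ0 hδ hc hcm hci hneg
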